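/- Let $(M,h)$ and $(N,g)$ be smooth finite-dimensional Riemannian manifolds (without boundary), let $\delta_1,\delta_2\in\mathbb{R}$, and let $\phi\colon M\to N$ be a smooth map. Denote by $\nabla$ the Levi-Civita connections and the connection they induce on $\phi^\ast TN$, by $\tau(\phi)=\operatorname{Tr}_h\nabla d\phi$ the tension field of $\phi$, and by $R^N(X,Y)Z=[\nabla_X,\nabla_Y]Z-\nabla_{[X,Y]}Z$ the curvature tensor of $N$. Let $e_\alpha$ be an orthonormal basis of $TM$, with summation over repeated indices. Suppose that $\phi$ is semi-biharmonic, that is, $$\delta_2\,\Delta\tau(\phi)=\delta_2\,R^N(d\phi(e_\alpha),\tau(\phi))\,d\phi(e_\alpha)+\delta_1\,\tau(\phi),\qquad \Delta:=\nabla_{e_\alpha}\nabla_{e_\alpha}-\nabla_{\nabla_{e_\alpha}e_\alpha},$$ where $\Delta$ is the connection Laplacian on $\phi^\ast TN$, and that $X$ is a (smooth) Killing vector field on $N$, that is, $(\mathcal{L}_Xg)(Y,Z)=\langle\nabla_YX,Z\rangle+\langle Y,\nabla_ZX\rangle=0$ for all $Y,Z$. Then the vector field $J=J_\alpha e_\alpha$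 on $M$ with $$J_\alpha:=\delta_1\langle d\phi(e_\alpha),X(\phi)\rangle+\delta_2\langle\tau(\phi),\nabla_{e_\alpha}(X(\phi))\rangle-\delta_2\langle\nabla_{e_\alpha}\tau(\phi),X(\phi)\rangle$$ is smooth and divergence free: $\operatorname{div}J=\operatorname{Tr}(v\mapsto\nabla_vJ)=0$ on $M$. -/

import Mathlib

open Bundle Manifold
open scoped ContDiff

noncomputable section

namespace SemiBiharmonic

section Riemannian

variable {n : ℕ} {N : Type*} [TopologicalSpace N] [ChartedSpace (EuclideanSpace ℝ (Fin n)) N]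

instance instFiniteDimensionalTangentSpace (y : N) : FiniteDimensional ℝ (TangentSpace (𝓡 n) y) :=
  inferInstanceAs (FiniteDimensional ℝ (EuclideanSpace ℝ (Fin n)))

variable [IsManifold (𝓡 n) ∞ N]

/-- The coordinate vector `∂_i` at the point `y`, for the preferred chart around `y₀`. (The
trivialization of the tangent bundle at `y₀` is the differential of that chart.) -/
def coordVec (y₀ : N) (i : Fin n) (y : N) : TangentSpace (𝓡 n) y :=
  (trivializationAt (EuclideanSpace ℝ (Fin n)) (TangentSpace (𝓡 n)) y₀).symmL ℝ y
    (EuclideanSpace.single i 1)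

/-- The coordinate one-form `dy^i` at the point `y`, for the preferred chart around `y₀`: it gives
the `i`-th component of a tangent vector with respect to the coordinate vectors `∂_1, …, ∂_n`. -/
def coordForm (y₀ : N) (i : Fin n) (y : N) (v : TangentSpace (𝓡 n) y) : ℝ :=
  (trivializationAt (EuclideanSpace ℝ (Fin n)) (TangentSpace (𝓡 n)) y₀).continuousLinearMapAt
    ℝ y v i

variable [RiemannianBundle (fun y : N ↦ TangentSpace (𝓡 n) y)]

/-- The components `g_{ij} = ⟨∂_i, ∂_j⟩` of the metric, as functions of the point `y`, in the
preferred chart around `y₀`. -/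
def metricCoeff (y₀ y : N) (i j : Fin n) : ℝ :=
  inner ℝ (coordVec y₀ i y) (coordVec y₀ j y)

/-- The partial derivative `∂_l g_{ij}` at the point `y`, in the preferred chart around `y₀`. -/
def metricCoeffDeriv (y₀ y : N) (l i j : Fin n) : ℝ :=
  mvfderiv (𝓡 n) (fun y' ↦ metricCoeff y₀ y' i j) y (coordVec y₀ l y)

/-- The Christoffel symbol
`Γ^k_{ij} = (1/2) ∑_l g^{kl} (∂_i g_{jl} + ∂_j g_{il} - ∂_l g_{ij})` of the Levi-Civita connection,
as a function of the point `y`, in the preferred chart around `y₀`. -/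
def christoffel (y₀ y : N) (k i j : Fin n) : ℝ :=
  (1 / 2) * ∑ l, (Matrix.of (metricCoeff y₀ y))⁻¹ k l *
    (metricCoeffDeriv y₀ y i j l + metricCoeffDeriv y₀ y j i l - metricCoeffDeriv y₀ y l i j)

/-- The orthonormal basis `e_α` of the tangent space at `y`, used to take traces with respect to
the metric (these do not depend on the choice of the basis). -/
def onb (y : N) :
    OrthonormalBasis (Fin (Module.finrank ℝ (TangentSpace (𝓡 n) y))) ℝ (TangentSpace (𝓡 n) y) :=
  stdOrthonormalBasis ℝ (TangentSpace (𝓡 n) y)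

/-- The trace with respect to the metric, `∑_α B (e_α, e_α)`, of a bilinear map `B` on the tangent
space at `y`. -/
def metricTrace {W : Type*} [AddCommGroup W] (y : N)
    (B : TangentSpace (𝓡 n) y → TangentSpace (𝓡 n) y → W) : W :=
  ∑ α, B (onb y α) (onb y α)

/-- The covariant derivative `∇_v σ` at the point `x` of a section `σ` of the pull-back bundle
`φ^* TN`, for the connection induced by the Levi-Civita connection of `N`. In the preferred chart
of `N` around `φ x`, its `k`-th component is
`v(σ^k) + ∑_{i,j} Γ^k_{ij}(φ x) dφ^i(v) σ^j(x)`. -/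
def covAlong {m : ℕ} {M : Type*} [TopologicalSpace M] [ChartedSpace (EuclideanSpace ℝ (Fin m)) M]
    (φ : M → N) (σ : ∀ x : M, TangentSpace (𝓡 n) (φ x)) (x : M) (v : TangentSpace (𝓡 m) x) :
    TangentSpace (𝓡 n) (φ x) :=
  ∑ k, (mvfderiv (𝓡 m) (fun x' ↦ coordForm (φ x) k (φ x') (σ x')) x v +
      ∑ i, ∑ j, christoffel (φ x) (φ x) k i j *
        coordForm (φ x) i (φ x) (mfderiv (𝓡 m) (𝓡 n) φ x v) *
        coordForm (φ x) j (φ x) (σ x)) • coordVec (φ x) k (φ x)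

/-- The Levi-Civita covariant derivative `∇_v Y` of a vector field `Y` at the point `y`. -/
def leviCivita (Y : ∀ y : N, TangentSpace (𝓡 n) y) (y : N) (v : TangentSpace (𝓡 n) y) :
    TangentSpace (𝓡 n) y :=
  covAlong (fun y' : N ↦ y') Y y v

/-- The extension of a tangent vector at `y` to a vector field with constant components in the
preferred chart around `y`. -/
def extension (y : N) (v : TangentSpace (𝓡 n) y) : ∀ y' : N, TangentSpace (𝓡 n) y' :=
  FiberBundle.extend (EuclideanSpace ℝ (Fin n)) v

/-- The curvature tensor `R(u, v) w = ∇_U ∇_V W - ∇_V ∇_U W - ∇_{[U, V]} W` at the point `y`,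
computed with extensions `U`, `V`, `W` of the tangent vectors `u`, `v`, `w` to vector fields (by
tensoriality, it does not depend on them). -/
def curvature (y : N) (u v w : TangentSpace (𝓡 n) y) : TangentSpace (𝓡 n) y :=
  leviCivita (fun y' ↦ leviCivita (extension y w) y' (extension y v y')) y u
    - leviCivita (fun y' ↦ leviCivita (extension y w) y' (extension y u y')) y v
    - leviCivita (extension y w) y (VectorField.mlieBracket (𝓡 n) (extension y u) (extension y v) y)

/-- The divergence `div V = ∑_α ⟨∇_{e_α} V, e_α⟩` of a vector field `V`. -/
def divergence (V : ∀ y : N, TangentSpace (𝓡 n) y) (y : N) : ℝ :=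
  metricTrace y fun u v ↦ inner ℝ (leviCivita V y u) v

/-- The Lie derivative of the metric along the vector field `X`,
`(L_X g)(u, v) = ⟨∇_u X, v⟩ + ⟨u, ∇_v X⟩`. -/
def lieDerivMetric (X : ∀ y : N, TangentSpace (𝓡 n) y) (y : N) (u v : TangentSpace (𝓡 n) y) : ℝ :=
  inner ℝ (leviCivita X y u) v + inner ℝ u (leviCivita X y v)

/-- A Killing vector field: a smooth vector field `X` with `L_X g = 0`. -/
structure IsKilling (X : ∀ y : N, TangentSpace (𝓡 n) y) : Prop where
  smooth : ContMDiff (𝓡 n) (𝓡 n).tangent ∞ fun y ↦ (⟨y, X y⟩ : TangentBundle (𝓡 n) N)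
  lieDerivMetric_eq_zero : ∀ (y : N) (u v : TangentSpace (𝓡 n) y), lieDerivMetric X y u v = 0

end Riemannian

section Maps

variable {m n : ℕ}
  {M : Type*} [TopologicalSpace M] [ChartedSpace (EuclideanSpace ℝ (Fin m)) M]
  [IsManifold (𝓡 m) ∞ M] [RiemannianBundle (fun x : M ↦ TangentSpace (𝓡 m) x)]
  {N : Type*} [TopologicalSpace N] [ChartedSpace (EuclideanSpace ℝ (Fin n)) N]
  [IsManifold (𝓡 n) ∞ N] [RiemannianBundle (fun y : N ↦ TangentSpace (𝓡 n) y)]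

/-- The second fundamental form `(∇dφ)(v, w) = ∇_v (dφ(W)) - dφ(∇_v W)` of the map `φ` at the
point `x`, where `W` is an extension of the tangent vector `w` to a vector field. -/
def hessian (φ : M → N) (x : M) (v w : TangentSpace (𝓡 m) x) : TangentSpace (𝓡 n) (φ x) :=
  covAlong φ (fun x' ↦ mfderiv (𝓡 m) (𝓡 n) φ x' (extension x w x')) x v
    - mfderiv (𝓡 m) (𝓡 n) φ x (leviCivita (extension x w) x v)

/-- The tension field `τ(φ) = Tr ∇dφ`. -/
def tension (φ : M → N) (x : M) : TangentSpace (𝓡 n) (φ x) :=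
  metricTrace (n := m) x (hessian (m := m) (n := n) φ x)

/-- The connection Laplacian `∑_α (∇_{e_α} ∇_{e_α} σ - ∇_{∇_{e_α} e_α} σ)` on sections `σ` of
`φ^* TN`, where in each summand `e_α` is extended to a vector field. -/
def connLaplacian (φ : M → N) (σ : ∀ x : M, TangentSpace (𝓡 n) (φ x)) (x : M) :
    TangentSpace (𝓡 n) (φ x) :=
  metricTrace (n := m) x fun v w ↦
    covAlong φ (fun x' ↦ covAlong φ σ x' (extension x w x')) x v
      - covAlong φ σ x (leviCivita (extension x w) x v)

/-- The equation of semi-biharmonic maps,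
`δ₂ Δτ(φ) = δ₂ ∑_α R^N(dφ(e_α), τ(φ)) dφ(e_α) + δ₁ τ(φ)`. -/
def IsSemiBiharmonic (δ₁ δ₂ : ℝ) (φ : M → N) : Prop :=
  ∀ x : M, δ₂ • connLaplacian (m := m) (n := n) φ (tension (m := m) (n := n) φ) x =
    δ₂ • metricTrace (n := m) x (fun v w ↦ curvature (n := n) (φ x)
        (mfderiv (𝓡 m) (𝓡 n) φ x v) (tension (m := m) (n := n) φ x) (mfderiv (𝓡 m) (𝓡 n) φ x w))
      + δ₁ • tension (m := m) (n := n) φ x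

/-- The value `⟨J, v⟩` of the Noether current on a tangent vector `v` at `x`,
`δ₁ ⟨dφ(v), X(φ)⟩ + δ₂ ⟨τ(φ), ∇_v X(φ)⟩ - δ₂ ⟨∇_v τ(φ), X(φ)⟩`; for `v = e_α` this is `J_α`. -/
def noetherForm (δ₁ δ₂ : ℝ) (φ : M → N) (X : ∀ y : N, TangentSpace (𝓡 n) y) (x : M)
    (v : TangentSpace (𝓡 m) x) : ℝ :=
  δ₁ * inner ℝ (mfderiv (𝓡 m) (𝓡 n) φ x v) (X (φ x))
    + δ₂ * inner ℝ (tension (m := m) (n := n) φ x) (covAlong (n := n) φ (fun x' ↦ X (φ x')) x v)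
    - δ₂ * inner ℝ (covAlong (n := n) φ (tension (m := m) (n := n) φ) x v) (X (φ x))

/-- The Noether current, the vector field `J = ∑_α J_α e_α` on `M`. -/
def noetherCurrent (δ₁ δ₂ : ℝ) (φ : M → N) (X : ∀ y : N, TangentSpace (𝓡 n) y) (x : M) :
    TangentSpace (𝓡 m) x :=
  ∑ α, noetherForm (m := m) (n := n) δ₁ δ₂ φ X x (onb (n := m) x α) • onb (n := m) x α

end Maps

end SemiBiharmonic

end

/-! Noether's theorem: an infinitesimal isometry of the target gives a conserved current. Fix `x`,
put ξ = X(φ), and differentiate ⟨J, E⟩ along e, where E extends e. Metric compatibility produces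
⟨∇_e τ, ∇_e ξ⟩ twice with opposite signs, and the terms containing ∇_e E complete the remaining
derivatives to tensorial ones. Summing over an orthonormal basis gives div J = δ₁⟨τ, ξ⟩ + δ₁
∑⟨dφ(e_α), ∇_{dφ(e_α)} X⟩ + δ₂⟨τ, Δξ⟩ - δ₂⟨Δτ, ξ⟩ (`inner_leviCivita_noetherCurrent`). The second
term vanishes because ∇X is skew. By the chain rule `secondCovAlong_comp`, Δξ = ∑ (∇²X)(dφ(e_α),
dφ(e_α)) + ∇_τ X, and ⟨τ, ∇_τ X⟩ = 0, again by skewness. The Killing identity ⟨t, (∇²X)(u, u)⟩ = ⟨X,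
R(u, t)u⟩ (`IsKilling.inner_secondCov_self`) turns the rest into ⟨δ₁τ + δ₂ ∑ R(dφ(e_α), τ)dφ(e_α) -
δ₂Δτ, ξ⟩, which is zero by the equation for φ.

Most of the work is to establish the calculus this uses. `covAlong` is defined at each point in the
chart centred at the image of that very point, so neither metric compatibility nor smoothness in the
point can be read off. Compatibility comes from the Koszul formula at the chart centre
(`mvfderiv_inner`). Together with symmetry of the connection it yields the Christoffel formula
throughout a fixed chart (`leviCivita_coordVec`), hence smoothness (`SmoothAt.covAlong`). Likewise
`onb` is chosen pointwise without any regularity, so traces are rewritten with the inverse metric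
matrix (`metricTrace_eq_sum`) before smoothness is claimed. -/

namespace SemiBiharmonic

open Filter Topology

/-! ### Coordinate frames and smooth sections along a map. -/

section Frames

variable {m n : ℕ}
  {M : Type*} [TopologicalSpace M] [ChartedSpace (EuclideanSpace ℝ (Fin m)) M]
  {N : Type*} [TopologicalSpace N] [ChartedSpace (EuclideanSpace ℝ (Fin n)) N]

/-- The domain of the preferred chart around `y₀`. -/
abbrev chartDomain (y₀ : N) : Set N := (chartAt (EuclideanSpace ℝ (Fin n)) y₀).source

lemma chartDomain_mem_nhds {y₀ y : N} (hy : y ∈ chartDomain (n := n) y₀) :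
    chartDomain (n := n) y₀ ∈ 𝓝 y :=
  (chartAt (EuclideanSpace ℝ (Fin n)) y₀).open_source.mem_nhds hy

lemma mem_chartDomain_self (y : N) : y ∈ chartDomain (n := n) y :=
  mem_chart_source _ y

variable [IsManifold (𝓡 n) ∞ N]

lemma coordForm_add (y₀ : N) (i : Fin n) (y : N) (u v : TangentSpace (𝓡 n) y) :
    coordForm y₀ i y (u + v) = coordForm y₀ i y u + coordForm y₀ i y v := by
  simp [coordForm]

lemma coordForm_smul (y₀ : N) (i : Fin n) (y : N) (c : ℝ) (v : TangentSpace (𝓡 n) y) :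
    coordForm y₀ i y (c • v) = c * coordForm y₀ i y v := by
  simp [coordForm]

lemma coordForm_zero (y₀ : N) (i : Fin n) (y : N) :
    coordForm y₀ i y (0 : TangentSpace (𝓡 n) y) = 0 := by
  simp [coordForm]

lemma coordForm_sum {ι : Type*} (s : Finset ι) (y₀ : N) (i : Fin n) (y : N)
    (v : ι → TangentSpace (𝓡 n) y) :
    coordForm y₀ i y (∑ a ∈ s, v a) = ∑ a ∈ s, coordForm y₀ i y (v a) := by
  classical
  induction s using Finset.induction_on with
  | empty => simp [coordForm_zero]
  | insert a s ha ih => rw [Finset.sum_insert ha, Finset.sum_insert ha, coordForm_add, ih]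

lemma coordForm_coordVec {y₀ y : N} (hy : y ∈ chartDomain (n := n) y₀) (i j : Fin n) :
    coordForm y₀ i y (coordVec y₀ j y) = if i = j then 1 else 0 := by
  rw [coordForm, coordVec, Trivialization.continuousLinearMapAt_symmL _ hy]
  simp

lemma sum_coordForm_smul_coordVec {y₀ y : N} (hy : y ∈ chartDomain (n := n) y₀)
    (v : TangentSpace (𝓡 n) y) : ∑ i, coordForm y₀ i y v • coordVec y₀ i y = v := by
  conv_rhs => rw [← Trivialization.symmL_continuousLinearMapAt (R := ℝ)
    (trivializationAt (EuclideanSpace ℝ (Fin n)) (TangentSpace (𝓡 n)) y₀) hy v]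
  simp only [coordForm, coordVec, ← map_smul, ← map_sum]
  congr 1
  ext i
  simp [Pi.single_apply]

lemma ext_coordForm {y₀ y : N} (hy : y ∈ chartDomain (n := n) y₀) {u v : TangentSpace (𝓡 n) y}
    (h : ∀ i, coordForm y₀ i y u = coordForm y₀ i y v) : u = v := by
  rw [← sum_coordForm_smul_coordVec hy u, ← sum_coordForm_smul_coordVec hy v]
  simp [h]

lemma extension_eq (y : N) (v : TangentSpace (𝓡 n) y) {y' : N}
    (hy' : y' ∈ chartDomain (n := n) y) :
    extension y v y' = ∑ i, coordForm y i y v • coordVec y i y' := by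
  have hy : y ∈ (trivializationAt (EuclideanSpace ℝ (Fin n)) (TangentSpace (𝓡 n)) y).baseSet :=
    FiberBundle.mem_baseSet_trivializationAt' y
  have : extension y v y' =
      (trivializationAt (EuclideanSpace ℝ (Fin n)) (TangentSpace (𝓡 n)) y).symmL ℝ y'
        ((trivializationAt (EuclideanSpace ℝ (Fin n)) (TangentSpace (𝓡 n)) y).continuousLinearMapAt
          ℝ y v) := by
    rw [Trivialization.symmL_apply _ hy', Trivialization.continuousLinearMapAt_apply_of_mem ℝ _ hy]
    rfl
  rw [this]
  simp only [coordForm, coordVec, ← map_smul, ← map_sum]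
  congr 1
  ext i
  simp [Pi.single_apply]

lemma extension_self (y : N) (v : TangentSpace (𝓡 n) y) : extension y v y = v :=
  FiberBundle.extend_apply_self _ v

/-- The section `σ` of `φ^* TN` is smooth at `x`. -/
abbrev SmoothAt (φ : M → N) (σ : ∀ x : M, TangentSpace (𝓡 n) (φ x)) (x : M) : Prop :=
  ContMDiffAt (𝓡 m) (𝓡 n).tangent ∞ (fun x' ↦ (⟨φ x', σ x'⟩ : TangentBundle (𝓡 n) N)) x

/-- The vector field `V` is smooth at `y`. -/
abbrev SmoothFieldAt (V : ∀ y : N, TangentSpace (𝓡 n) y) (y : N) : Prop :=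
  SmoothAt (m := n) (n := n) (fun y' ↦ y') V y

/-- The real function `f` is smooth at `x`. -/
abbrev SmoothFunAt (f : M → ℝ) (x : M) : Prop := ContMDiffAt (𝓡 m) 𝓘(ℝ) ∞ f x

lemma SmoothFunAt.mdifferentiableAt {f : M → ℝ} {x : M} (hf : SmoothFunAt (m := m) f x) :
    MDifferentiableAt (𝓡 m) 𝓘(ℝ) f x :=
  ContMDiffAt.mdifferentiableAt hf (by simp)

/-- Smoothness may be tested on components in any chart whose domain contains `φ x`, not only the
one centred there; this is what allows a fixed frame while the point moves. -/
lemma smoothAt_iff {φ : M → N} {σ : ∀ x : M, TangentSpace (𝓡 n) (φ x)} {x : M} {y₀ : N}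
    (hx : φ x ∈ chartDomain (n := n) y₀) :
    SmoothAt (m := m) φ σ x ↔ ContMDiffAt (𝓡 m) (𝓡 n) ∞ φ x ∧
      ∀ i, SmoothFunAt (m := m) (fun x' ↦ coordForm y₀ i (φ x') (σ x')) x := by
  have hs : (⟨φ x, σ x⟩ : TangentBundle (𝓡 n) N) ∈
      (trivializationAt (EuclideanSpace ℝ (Fin n)) (TangentSpace (𝓡 n)) y₀).source :=
    (Trivialization.mem_source _).2 hx
  rw [SmoothAt, Trivialization.contMDiffAt_iff
    (f := fun x' ↦ (⟨φ x', σ x'⟩ : TangentBundle (𝓡 n) N)) (x₀ := x) hs]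
  refine and_congr_right fun hφ ↦ ?_
  have h : ∀ᶠ x' in 𝓝 x, φ x' ∈ chartDomain (n := n) y₀ :=
    hφ.continuousAt.eventually (chartDomain_mem_nhds hx)
  have key : ContMDiffAt (𝓡 m) 𝓘(ℝ, EuclideanSpace ℝ (Fin n)) ∞ (fun x' ↦
      ((trivializationAt (EuclideanSpace ℝ (Fin n)) (TangentSpace (𝓡 n)) y₀)
        (⟨φ x', σ x'⟩ : TangentBundle (𝓡 n) N)).2) x ↔
      ContMDiffAt (𝓡 m) 𝓘(ℝ, EuclideanSpace ℝ (Fin n)) ∞ (fun x' ↦ WithLp.toLp 2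
        (fun i ↦ coordForm y₀ i (φ x') (σ x'))) x := by
    refine Filter.EventuallyEq.contMDiffAt_iff (h.mono fun x' hx' ↦ ?_)
    simp only [coordForm, Trivialization.continuousLinearMapAt_apply_of_mem ℝ _ (
      show φ x' ∈ (trivializationAt (EuclideanSpace ℝ (Fin n)) (TangentSpace (𝓡 n)) y₀).baseSet
        from hx')]
  refine key.trans ⟨fun H i ↦ ?_, fun H ↦ ?_⟩
  · exact ((EuclideanSpace.proj (𝕜 := ℝ) i).contDiff.contMDiff.contMDiffAt
      (x := WithLp.toLp 2 (fun i ↦ coordForm y₀ i (φ x) (σ x)))).comp x H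
  · have h1 : ContMDiffAt (𝓡 m) 𝓘(ℝ, Fin n → ℝ) ∞
        (fun x' i ↦ coordForm y₀ i (φ x') (σ x')) x := contMDiffAt_pi_space.2 H
    exact ((PiLp.continuousLinearEquiv 2 ℝ (fun _ : Fin n ↦ ℝ)).symm.contDiff.contMDiff.contMDiffAt
      (x := fun i ↦ coordForm y₀ i (φ x) (σ x))).comp x h1

lemma SmoothAt.base {φ : M → N} {σ : ∀ x : M, TangentSpace (𝓡 n) (φ x)} {x : M}
    (h : SmoothAt (m := m) φ σ x) : ContMDiffAt (𝓡 m) (𝓡 n) ∞ φ x :=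
  ((smoothAt_iff (mem_chartDomain_self (φ x))).1 h).1

lemma SmoothAt.coord {φ : M → N} {σ : ∀ x : M, TangentSpace (𝓡 n) (φ x)} {x : M} {y₀ : N}
    (h : SmoothAt (m := m) φ σ x) (hx : φ x ∈ chartDomain (n := n) y₀) (i : Fin n) :
    SmoothFunAt (m := m) (fun x' ↦ coordForm y₀ i (φ x') (σ x')) x :=
  ((smoothAt_iff hx).1 h).2 i

lemma SmoothAt.congr {φ : M → N} {σ ρ : ∀ x : M, TangentSpace (𝓡 n) (φ x)} {x : M}
    (h : SmoothAt (m := m) φ σ x) (he : ∀ᶠ x' in 𝓝 x, ρ x' = σ x') : SmoothAt (m := m) φ ρ x :=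
  ContMDiffAt.congr_of_eventuallyEq h (he.mono fun x' hx' ↦ by simp only [hx'])

lemma SmoothAt.add {φ : M → N} {σ ρ : ∀ x : M, TangentSpace (𝓡 n) (φ x)} {x : M}
    (hσ : SmoothAt (m := m) φ σ x) (hρ : SmoothAt (m := m) φ ρ x) :
    SmoothAt (m := m) φ (fun x' ↦ σ x' + ρ x') x := by
  refine (smoothAt_iff (mem_chartDomain_self (φ x))).2 ⟨hσ.base, fun i ↦ ?_⟩
  simp only [coordForm_add]
  exact (hσ.coord (mem_chartDomain_self _) i).add (hρ.coord (mem_chartDomain_self _) i)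

lemma SmoothAt.smul {φ : M → N} {f : M → ℝ} {σ : ∀ x : M, TangentSpace (𝓡 n) (φ x)} {x : M}
    (hf : SmoothFunAt (m := m) f x) (hσ : SmoothAt (m := m) φ σ x) :
    SmoothAt (m := m) φ (fun x' ↦ f x' • σ x') x := by
  refine (smoothAt_iff (mem_chartDomain_self (φ x))).2 ⟨hσ.base, fun i ↦ ?_⟩
  simp only [coordForm_smul]
  exact ContMDiffAt.mul hf (hσ.coord (mem_chartDomain_self _) i)

lemma SmoothAt.sub {φ : M → N} {σ ρ : ∀ x : M, TangentSpace (𝓡 n) (φ x)} {x : M}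
    (hσ : SmoothAt (m := m) φ σ x) (hρ : SmoothAt (m := m) φ ρ x) :
    SmoothAt (m := m) φ (fun x' ↦ σ x' - ρ x') x := by
  refine (hσ.add (SmoothAt.smul (f := fun _ ↦ -1) contMDiffAt_const hρ)).congr
    (Eventually.of_forall fun x' ↦ ?_)
  simp [sub_eq_add_neg]

lemma SmoothAt.sum {ι : Type*} {s : Finset ι} {φ : M → N}
    {σ : ι → ∀ x : M, TangentSpace (𝓡 n) (φ x)} {x : M} (hφ : ContMDiffAt (𝓡 m) (𝓡 n) ∞ φ x)
    (hσ : ∀ a ∈ s, SmoothAt (m := m) φ (σ a) x) :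
    SmoothAt (m := m) φ (fun x' ↦ ∑ a ∈ s, σ a x') x := by
  refine (smoothAt_iff (mem_chartDomain_self (φ x))).2 ⟨hφ, fun i ↦ ?_⟩
  simp only [coordForm_sum]
  exact ContMDiffAt.sum fun a ha ↦ (hσ a ha).coord (mem_chartDomain_self _) i

lemma smoothFieldAt_coordVec {y₀ y : N} (hy : y ∈ chartDomain (n := n) y₀) (i : Fin n) :
    SmoothFieldAt (n := n) (coordVec y₀ i) y := by
  refine (smoothAt_iff (φ := fun y' : N ↦ y') hy).2 ⟨contMDiffAt_id, fun j ↦ ?_⟩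
  refine ContMDiffAt.congr_of_eventuallyEq (contMDiffAt_const (c := if j = i then (1 : ℝ) else 0))
    ?_
  filter_upwards [chartDomain_mem_nhds hy] with y' hy'
  exact coordForm_coordVec hy' j i

lemma eventually_smoothFieldAt_coordVec (y : N) (i : Fin n) :
    ∀ᶠ y' in 𝓝 y, SmoothFieldAt (n := n) (coordVec y i) y' :=
  mem_of_superset (chartDomain_mem_nhds (mem_chartDomain_self y)) fun _ h ↦
    smoothFieldAt_coordVec h i

lemma SmoothFieldAt.comp {φ : M → N} {Y : ∀ y : N, TangentSpace (𝓡 n) y} {x : M}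
    (hY : SmoothFieldAt Y (φ x)) (hφ : ContMDiffAt (𝓡 m) (𝓡 n) ∞ φ x) :
    SmoothAt (m := m) φ (fun x' ↦ Y (φ x')) x :=
  ContMDiffAt.comp x (show ContMDiffAt (𝓡 n) (𝓡 n).tangent ∞
    (fun y ↦ (⟨y, Y y⟩ : TangentBundle (𝓡 n) N)) (φ x) from hY) hφ

lemma smoothFieldAt_extension {y y' : N} (v : TangentSpace (𝓡 n) y)
    (hy' : y' ∈ chartDomain (n := n) y) : SmoothFieldAt (n := n) (extension y v) y' := by
  refine SmoothAt.congr (σ := fun y' ↦ ∑ i, coordForm y i y v • coordVec y i y')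
    (SmoothAt.sum contMDiffAt_id fun i _ ↦
      SmoothAt.smul contMDiffAt_const (smoothFieldAt_coordVec hy' i)) ?_
  filter_upwards [chartDomain_mem_nhds hy'] with z hz
  exact extension_eq y v hz

lemma eventually_smoothFieldAt_extension (y : N) (v : TangentSpace (𝓡 n) y) :
    ∀ᶠ y' in 𝓝 y, SmoothFieldAt (n := n) (extension y v) y' :=
  mem_of_superset (chartDomain_mem_nhds (mem_chartDomain_self y)) fun _ ↦ smoothFieldAt_extension v

/-- Decomposition of a section of `φ^* TN` in a coordinate frame. -/
lemma eventually_eq_sum_coordVec {φ : M → N} (σ : ∀ x : M, TangentSpace (𝓡 n) (φ x)) {x : M}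
    {y₀ : N} (hφ : ContinuousAt φ x) (hx : φ x ∈ chartDomain (n := n) y₀) :
    ∀ᶠ x' in 𝓝 x, σ x' = ∑ i, coordForm y₀ i (φ x') (σ x') • coordVec y₀ i (φ x') :=
  (hφ.eventually (chartDomain_mem_nhds hx)).mono fun _ h ↦ (sum_coordForm_smul_coordVec h _).symm

end Frames

/-! ### Algebraic rules for the connection along a map: linearity, Leibniz rule, pull-back. -/

section CovAlong

variable {m n : ℕ}
  {M : Type*} [TopologicalSpace M] [ChartedSpace (EuclideanSpace ℝ (Fin m)) M]
  {N : Type*} [TopologicalSpace N] [ChartedSpace (EuclideanSpace ℝ (Fin n)) N]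

lemma mvfderiv_congr {f g : M → ℝ} {x : M} (h : ∀ᶠ x' in 𝓝 x, f x' = g x') :
    mvfderiv (𝓡 m) f x = mvfderiv (𝓡 m) g x := by
  ext v
  simp only [mvfderiv, ContinuousLinearMap.comp_apply]
  rw [Filter.EventuallyEq.mfderiv_eq h]
  rfl

lemma SmoothFunAt.mul {f g : M → ℝ} {x : M} (hf : SmoothFunAt (m := m) f x)
    (hg : SmoothFunAt (m := m) g x) : SmoothFunAt (m := m) (fun x' ↦ f x' * g x') x :=
  ContMDiffAt.mul hf hg

lemma mvfderiv_fun_mul_apply {f g : M → ℝ} {x : M} (hf : SmoothFunAt (m := m) f x)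
    (hg : SmoothFunAt (m := m) g x) (v : TangentSpace (𝓡 m) x) :
    mvfderiv (𝓡 m) (fun x' ↦ f x' * g x') x v =
      f x * mvfderiv (𝓡 m) g x v + mvfderiv (𝓡 m) f x v * g x := by
  have := congrArg (fun L ↦ L v) (mvfderiv_fun_mul hf.mdifferentiableAt hg.mdifferentiableAt)
  simp only [add_apply, smul_apply, smul_eq_mul] at this
  rw [this]
  ring

lemma mvfderiv_fun_add_apply {f g : M → ℝ} {x : M} (hf : SmoothFunAt (m := m) f x)
    (hg : SmoothFunAt (m := m) g x) (v : TangentSpace (𝓡 m) x) :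
    mvfderiv (𝓡 m) (fun x' ↦ f x' + g x') x v =
      mvfderiv (𝓡 m) f x v + mvfderiv (𝓡 m) g x v := by
  have := congrArg (fun L ↦ L v) (mvfderiv_fun_add hf.mdifferentiableAt hg.mdifferentiableAt)
  simpa only [add_apply] using this

lemma mvfderiv_fun_const_mul_apply {f : M → ℝ} {x : M} (c : ℝ) (hf : SmoothFunAt (m := m) f x)
    (v : TangentSpace (𝓡 m) x) :
    mvfderiv (𝓡 m) (fun x' ↦ c * f x') x v = c * mvfderiv (𝓡 m) f x v := by
  rw [mvfderiv_fun_mul_apply contMDiffAt_const hf, mvfderiv_const]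
  simp

lemma mvfderiv_fun_sum_apply {ι : Type*} {s : Finset ι} {f : ι → M → ℝ} {x : M}
    (hf : ∀ a ∈ s, SmoothFunAt (m := m) (f a) x) (v : TangentSpace (𝓡 m) x) :
    mvfderiv (𝓡 m) (fun x' ↦ ∑ a ∈ s, f a x') x v = ∑ a ∈ s, mvfderiv (𝓡 m) (f a) x v := by
  classical
  induction s using Finset.induction_on with
  | empty => simp [mvfderiv_const]
  | insert a s ha ih =>
    simp only [Finset.sum_insert ha]
    rw [mvfderiv_fun_add_apply (hf a (Finset.mem_insert_self a s))
      (ContMDiffAt.sum fun b hb ↦ hf b (Finset.mem_insert_of_mem hb)),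
      ih fun b hb ↦ hf b (Finset.mem_insert_of_mem hb)]

lemma mvfderiv_fun_comp_apply {φ : M → N} {f : N → ℝ} {x : M}
    (hf : SmoothFunAt (m := n) f (φ x)) (hφ : ContMDiffAt (𝓡 m) (𝓡 n) ∞ φ x)
    (v : TangentSpace (𝓡 m) x) :
    mvfderiv (𝓡 m) (fun x' ↦ f (φ x')) x v =
      mvfderiv (𝓡 n) f (φ x) (mfderiv (𝓡 m) (𝓡 n) φ x v) :=
  mvfderiv_comp_apply x hf.mdifferentiableAt (hφ.mdifferentiableAt (by simp)) v

variable [IsManifold (𝓡 n) ∞ N] [RiemannianBundle (fun y : N ↦ TangentSpace (𝓡 n) y)]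

lemma coordForm_covAlong (φ : M → N) (σ : ∀ x : M, TangentSpace (𝓡 n) (φ x)) (x : M)
    (v : TangentSpace (𝓡 m) x) (k : Fin n) :
    coordForm (φ x) k (φ x) (covAlong φ σ x v) =
      mvfderiv (𝓡 m) (fun x' ↦ coordForm (φ x) k (φ x') (σ x')) x v +
      ∑ i, ∑ j, christoffel (φ x) (φ x) k i j *
        coordForm (φ x) i (φ x) (mfderiv (𝓡 m) (𝓡 n) φ x v) *
        coordForm (φ x) j (φ x) (σ x) := by
  rw [covAlong, coordForm_sum]
  simp [coordForm_smul, coordForm_coordVec (mem_chartDomain_self (φ x))]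

lemma covAlong_congr {φ : M → N} {σ ρ : ∀ x : M, TangentSpace (𝓡 n) (φ x)} {x : M}
    (h : ∀ᶠ x' in 𝓝 x, σ x' = ρ x') (v : TangentSpace (𝓡 m) x) :
    covAlong φ σ x v = covAlong φ ρ x v := by
  refine ext_coordForm (mem_chartDomain_self (φ x)) fun k ↦ ?_
  rw [coordForm_covAlong, coordForm_covAlong, h.self_of_nhds,
    mvfderiv_congr (h.mono fun x' hx' ↦ by rw [hx'])]

lemma covAlong_map_add (φ : M → N) (σ : ∀ x : M, TangentSpace (𝓡 n) (φ x)) (x : M)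
    (v w : TangentSpace (𝓡 m) x) :
    covAlong φ σ x (v + w) = covAlong φ σ x v + covAlong φ σ x w := by
  refine ext_coordForm (mem_chartDomain_self (φ x)) fun k ↦ ?_
  rw [coordForm_add, coordForm_covAlong, coordForm_covAlong, coordForm_covAlong, map_add, map_add,
    add_add_add_comm, ← Finset.sum_add_distrib]
  congr 1
  refine Finset.sum_congr rfl fun i _ ↦ ?_
  rw [← Finset.sum_add_distrib]
  refine Finset.sum_congr rfl fun j _ ↦ ?_
  rw [coordForm_add]
  ring

lemma covAlong_map_smul (φ : M → N) (σ : ∀ x : M, TangentSpace (𝓡 n) (φ x)) (x : M)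
    (c : ℝ) (v : TangentSpace (𝓡 m) x) :
    covAlong φ σ x (c • v) = c • covAlong φ σ x v := by
  refine ext_coordForm (mem_chartDomain_self (φ x)) fun k ↦ ?_
  rw [coordForm_smul, coordForm_covAlong, coordForm_covAlong, map_smul, map_smul, mul_add,
    Finset.mul_sum, smul_eq_mul]
  congr 1
  refine Finset.sum_congr rfl fun i _ ↦ ?_
  rw [Finset.mul_sum]
  refine Finset.sum_congr rfl fun j _ ↦ ?_
  rw [coordForm_smul]
  ring

lemma covAlong_map_sum {ι : Type*} (s : Finset ι) (φ : M → N)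
    (σ : ∀ x : M, TangentSpace (𝓡 n) (φ x)) (x : M) (c : ι → ℝ) (v : ι → TangentSpace (𝓡 m) x) :
    covAlong φ σ x (∑ a ∈ s, c a • v a) = ∑ a ∈ s, c a • covAlong φ σ x (v a) := by
  let D : TangentSpace (𝓡 m) x →ₗ[ℝ] TangentSpace (𝓡 n) (φ x) :=
    { toFun := covAlong φ σ x
      map_add' := covAlong_map_add φ σ x
      map_smul' := covAlong_map_smul φ σ x }
  have : D (∑ a ∈ s, c a • v a) = ∑ a ∈ s, c a • D (v a) := by simp only [map_sum, map_smul]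
  exact this

lemma covAlong_add {φ : M → N} {σ ρ : ∀ x : M, TangentSpace (𝓡 n) (φ x)} {x : M}
    (hσ : SmoothAt (m := m) φ σ x) (hρ : SmoothAt (m := m) φ ρ x) (v : TangentSpace (𝓡 m) x) :
    covAlong φ (fun x' ↦ σ x' + ρ x') x v = covAlong φ σ x v + covAlong φ ρ x v := by
  have hx := mem_chartDomain_self (n := n) (φ x)
  refine ext_coordForm hx fun k ↦ ?_
  rw [coordForm_add, coordForm_covAlong, coordForm_covAlong, coordForm_covAlong]
  simp only [coordForm_add, mul_add, Finset.sum_add_distrib]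
  rw [mvfderiv_fun_add_apply (hσ.coord hx k) (hρ.coord hx k)]
  ring

lemma covAlong_smul {φ : M → N} {f : M → ℝ} {σ : ∀ x : M, TangentSpace (𝓡 n) (φ x)} {x : M}
    (hf : SmoothFunAt (m := m) f x) (hσ : SmoothAt (m := m) φ σ x) (v : TangentSpace (𝓡 m) x) :
    covAlong φ (fun x' ↦ f x' • σ x') x v =
      mvfderiv (𝓡 m) f x v • σ x + f x • covAlong φ σ x v := by
  have hx := mem_chartDomain_self (n := n) (φ x)
  refine ext_coordForm hx fun k ↦ ?_
  rw [coordForm_add, coordForm_smul, coordForm_smul, coordForm_covAlong, coordForm_covAlong]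
  simp only [coordForm_smul]
  rw [mvfderiv_fun_mul_apply hf (hσ.coord hx k), mul_add, Finset.mul_sum]
  have : ∀ i, f x * ∑ j, christoffel (φ x) (φ x) k i j *
        coordForm (φ x) i (φ x) (mfderiv (𝓡 m) (𝓡 n) φ x v) * coordForm (φ x) j (φ x) (σ x) =
      ∑ j, christoffel (φ x) (φ x) k i j *
        coordForm (φ x) i (φ x) (mfderiv (𝓡 m) (𝓡 n) φ x v) *
        (f x * coordForm (φ x) j (φ x) (σ x)) := fun i ↦ by
    rw [Finset.mul_sum]
    exact Finset.sum_congr rfl fun j _ ↦ by ring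
  simp only [this]
  ring

lemma covAlong_sum {ι : Type*} {s : Finset ι} {φ : M → N}
    {σ : ι → ∀ x : M, TangentSpace (𝓡 n) (φ x)} {x : M}
    (hσ : ∀ a ∈ s, SmoothAt (m := m) φ (σ a) x) (v : TangentSpace (𝓡 m) x) :
    covAlong φ (fun x' ↦ ∑ a ∈ s, σ a x') x v = ∑ a ∈ s, covAlong φ (σ a) x v := by
  have hx := mem_chartDomain_self (n := n) (φ x)
  refine ext_coordForm hx fun k ↦ ?_
  rw [coordForm_sum, coordForm_covAlong]
  simp only [coordForm_covAlong, coordForm_sum]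
  rw [mvfderiv_fun_sum_apply (fun a ha ↦ (hσ a ha).coord hx k), Finset.sum_add_distrib]
  congr 1
  simp only [Finset.mul_sum]
  conv_rhs => rw [Finset.sum_comm]
  refine Finset.sum_congr rfl fun i _ ↦ ?_
  conv_rhs => rw [Finset.sum_comm]

/-- The connection along `φ` is the pull-back of the Levi-Civita connection. -/
lemma covAlong_comp {φ : M → N} {Y : ∀ y : N, TangentSpace (𝓡 n) y} {x : M}
    (hφ : ContMDiffAt (𝓡 m) (𝓡 n) ∞ φ x) (hY : SmoothFieldAt Y (φ x))
    (v : TangentSpace (𝓡 m) x) :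
    covAlong φ (fun x' ↦ Y (φ x')) x v =
      leviCivita Y (φ x) (mfderiv (𝓡 m) (𝓡 n) φ x v) := by
  have hx := mem_chartDomain_self (n := n) (φ x)
  refine ext_coordForm hx fun k ↦ ?_
  -- Both sides use the chart centred at `φ x`, so the Christoffel terms agree and only the chain
  -- rule for the components of `Y` is left.
  rw [coordForm_covAlong, leviCivita]
  erw [coordForm_covAlong (fun y' : N ↦ y') Y (φ x) (mfderiv (𝓡 m) (𝓡 n) φ x v) k]
  have hid : mfderiv (𝓡 n) (𝓡 n) (fun y' : N ↦ y') (φ x) = ContinuousLinearMap.id ℝ _ := mfderiv_id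
  rw [hid]
  have := mvfderiv_fun_comp_apply (f := fun y ↦ coordForm (φ x) k y (Y y))
    (SmoothAt.coord (φ := fun y' : N ↦ y') hY hx k) hφ v
  rw [this]
  rfl

end CovAlong

/-! ### Compatibility of the connection with the metric. -/

section Metric

variable {m n : ℕ}
  {M : Type*} [TopologicalSpace M] [ChartedSpace (EuclideanSpace ℝ (Fin m)) M]
  {N : Type*} [TopologicalSpace N] [ChartedSpace (EuclideanSpace ℝ (Fin n)) N]
  [IsManifold (𝓡 n) ∞ N]

lemma linearIndependent_coordVec {y₀ y : N} (hy : y ∈ chartDomain (n := n) y₀) :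
    LinearIndependent ℝ (fun i : Fin n ↦ coordVec y₀ i y) := by
  rw [Fintype.linearIndependent_iff]
  intro c hc i
  have := congrArg (coordForm y₀ i y) hc
  simpa [coordForm_sum, coordForm_smul, coordForm_coordVec hy, coordForm_zero] using this

variable [RiemannianBundle (fun y : N ↦ TangentSpace (𝓡 n) y)]

lemma isUnit_det_metricCoeff {y₀ y : N} (hy : y ∈ chartDomain (n := n) y₀) :
    IsUnit (Matrix.of (metricCoeff (n := n) y₀ y)).det := by
  have h : Matrix.of (metricCoeff (n := n) y₀ y) =
      Matrix.gram ℝ (fun i : Fin n ↦ coordVec y₀ i y) := rfl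
  have hpos : 0 < (Matrix.gram ℝ (fun i : Fin n ↦ coordVec y₀ i y)).det :=
    Matrix.PosDef.det_pos (Matrix.posDef_gram_of_linearIndependent (linearIndependent_coordVec hy))
  rw [h]
  exact isUnit_iff_ne_zero.2 hpos.ne'

lemma metricCoeff_comm (y₀ y : N) (i j : Fin n) :
    metricCoeff y₀ y i j = metricCoeff y₀ y j i :=
  real_inner_comm _ _

lemma metricCoeffDeriv_comm (y₀ y : N) (l i j : Fin n) :
    metricCoeffDeriv y₀ y l i j = metricCoeffDeriv y₀ y l j i := by
  simp only [metricCoeffDeriv, metricCoeff_comm y₀ _ i j]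

lemma christoffel_comm (y₀ y : N) (k i j : Fin n) :
    christoffel y₀ y k i j = christoffel y₀ y k j i := by
  simp only [christoffel]
  congr 1
  refine Finset.sum_congr rfl fun l _ ↦ ?_
  rw [metricCoeffDeriv_comm y₀ y l i j]
  ring

/-- The Christoffel symbols of the first kind. -/
lemma sum_christoffel_mul_metricCoeff {y₀ y : N} (hy : y ∈ chartDomain (n := n) y₀)
    (i j l : Fin n) :
    ∑ k, christoffel y₀ y k i j * metricCoeff y₀ y k l =
      (1 / 2) * (metricCoeffDeriv y₀ y i j l + metricCoeffDeriv y₀ y j i l -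
        metricCoeffDeriv y₀ y l i j) := by
  set G := Matrix.of (metricCoeff (n := n) y₀ y) with hG
  set c : Fin n → ℝ := fun l ↦ metricCoeffDeriv y₀ y i j l + metricCoeffDeriv y₀ y j i l -
        metricCoeffDeriv y₀ y l i j with hc
  have h : G.mulVec (G⁻¹.mulVec c) = c := by
    rw [Matrix.mulVec_mulVec, Matrix.mul_nonsing_inv _ (isUnit_det_metricCoeff hy),
      Matrix.one_mulVec]
  have h1 := congrFun h l
  simp only [Matrix.mulVec, dotProduct] at h1
  rw [show metricCoeffDeriv y₀ y i j l + metricCoeffDeriv y₀ y j i l -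
        metricCoeffDeriv y₀ y l i j = c l from rfl, ← h1, Finset.mul_sum]
  refine Finset.sum_congr rfl fun k _ ↦ ?_
  rw [christoffel, metricCoeff_comm]
  simp only [hG, Matrix.of_apply, hc]
  ring

/-- The components of a coordinate field are constant in its own chart, so only the Christoffel term
survives. This is immediate only at the centre, where the chart of the frame is the one used to
define the connection; `leviCivita_coordVec` covers the whole chart. -/
lemma leviCivita_coordVec_self (y : N) (i j : Fin n) :
    leviCivita (coordVec y j) y (coordVec y i y) =
      ∑ k, christoffel y y k i j • coordVec y k y := by
  have hy := mem_chartDomain_self (n := n) y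
  refine ext_coordForm hy fun k ↦ ?_
  rw [leviCivita]
  refine (coordForm_covAlong (fun y' : N ↦ y') (coordVec y j) y (coordVec y i y) k).trans ?_
  have hid : mfderiv (𝓡 n) (𝓡 n) (fun y' : N ↦ y') y = ContinuousLinearMap.id ℝ _ := mfderiv_id
  have hc : mvfderiv (𝓡 n) (fun y' ↦ coordForm y k y' (coordVec y j y')) y =
      mvfderiv (𝓡 n) (fun _ : N ↦ if k = j then (1 : ℝ) else 0) y :=
    mvfderiv_congr <| mem_of_superset (chartDomain_mem_nhds hy)
      fun y' hy' ↦ coordForm_coordVec hy' k j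
  rw [hid, hc, mvfderiv_const]
  simp only [coordForm_sum, coordForm_smul, coordForm_coordVec hy, ContinuousLinearMap.id_apply]
  simp

/-- The Koszul formula for coordinate fields at the centre of the chart. -/
lemma inner_leviCivita_coordVec_self (y : N) (i j l : Fin n) :
    inner ℝ (leviCivita (coordVec y j) y (coordVec y i y)) (coordVec y l y) =
      (1 / 2) * (metricCoeffDeriv y y i j l + metricCoeffDeriv y y j i l -
        metricCoeffDeriv y y l i j) := by
  rw [leviCivita_coordVec_self, sum_inner,
    ← sum_christoffel_mul_metricCoeff (mem_chartDomain_self y)]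
  simp only [real_inner_smul_left]
  rfl

lemma mvfderiv_metricCoeff (y : N) (i j : Fin n) (v : TangentSpace (𝓡 n) y) :
    mvfderiv (𝓡 n) (fun y' ↦ metricCoeff y y' i j) y v =
      inner ℝ (leviCivita (coordVec y i) y v) (coordVec y j y) +
      inner ℝ (coordVec y i y) (leviCivita (coordVec y j) y v) := by
  have hy := mem_chartDomain_self (n := n) y
  -- In the sum of the two Koszul expressions everything but ∂_l g_{ij} cancels by symmetry of g.
  have h (l : Fin n) : metricCoeffDeriv y y l i j =
      inner ℝ (leviCivita (coordVec y i) y (coordVec y l y)) (coordVec y j y) +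
      inner ℝ (coordVec y i y) (leviCivita (coordVec y j) y (coordVec y l y)) := by
    rw [inner_leviCivita_coordVec_self, real_inner_comm,
      inner_leviCivita_coordVec_self, metricCoeffDeriv_comm y y i l j,
      metricCoeffDeriv_comm y y l j i, metricCoeffDeriv_comm y y j l i]
    ring
  rw [← sum_coordForm_smul_coordVec hy v, map_sum]
  simp only [leviCivita]
  rw [covAlong_map_sum, covAlong_map_sum, sum_inner, inner_sum, ← Finset.sum_add_distrib]
  refine Finset.sum_congr rfl fun l _ ↦ ?_
  rw [map_smul, smul_eq_mul, real_inner_smul_left, real_inner_smul_right, ← mul_add]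
  exact congrArg _ (h l)

variable [IsContMDiffRiemannianBundle (𝓡 n) ∞ (EuclideanSpace ℝ (Fin n))
  (fun y : N ↦ TangentSpace (𝓡 n) y)]

lemma SmoothAt.inner {φ : M → N} {σ ρ : ∀ x : M, TangentSpace (𝓡 n) (φ x)} {x : M}
    (hσ : SmoothAt (m := m) φ σ x) (hρ : SmoothAt (m := m) φ ρ x) :
    SmoothFunAt (m := m) (fun x' ↦ inner ℝ (σ x') (ρ x')) x :=
  ContMDiffAt.inner_bundle hσ hρ

/-- If the product rule for the metric holds against each `ρ a`, it holds against their combinations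
with function coefficients. It reduces the general product rule to frame fields. -/
lemma mvfderiv_inner_sum_smul {ι : Type*} {s : Finset ι} {φ : M → N}
    {σ : ∀ x : M, TangentSpace (𝓡 n) (φ x)} {f : ι → M → ℝ}
    {ρ : ι → ∀ x : M, TangentSpace (𝓡 n) (φ x)} {x : M} {v : TangentSpace (𝓡 m) x}
    (hσ : SmoothAt (m := m) φ σ x)
    (hf : ∀ a ∈ s, SmoothFunAt (m := m) (f a) x) (hρ : ∀ a ∈ s, SmoothAt (m := m) φ (ρ a) x)
    (h : ∀ a ∈ s, mvfderiv (𝓡 m) (fun x' ↦ inner ℝ (σ x') (ρ a x')) x v =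
      inner ℝ (covAlong φ σ x v) (ρ a x) + inner ℝ (σ x) (covAlong φ (ρ a) x v)) :
    mvfderiv (𝓡 m) (fun x' ↦ inner ℝ (σ x') (∑ a ∈ s, f a x' • ρ a x')) x v =
      inner ℝ (covAlong φ σ x v) (∑ a ∈ s, f a x • ρ a x) +
      inner ℝ (σ x) (covAlong φ (fun x' ↦ ∑ a ∈ s, f a x' • ρ a x') x v) := by
  rw [covAlong_sum fun a ha ↦ SmoothAt.smul (hf a ha) (hρ a ha)]
  simp only [inner_sum, real_inner_smul_right]
  rw [mvfderiv_fun_sum_apply fun a ha ↦ SmoothFunAt.mul (hf a ha) (hσ.inner (hρ a ha)),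
    ← Finset.sum_add_distrib]
  refine Finset.sum_congr rfl fun a ha ↦ ?_
  rw [mvfderiv_fun_mul_apply (hf a ha) (hσ.inner (hρ a ha)), h a ha,
    covAlong_smul (hf a ha) (hρ a ha), inner_add_right, real_inner_smul_right,
    real_inner_smul_right]
  ring

lemma smoothFunAt_metricCoeff {y₀ y : N} (hy : y ∈ chartDomain (n := n) y₀) (i j : Fin n) :
    SmoothFunAt (m := n) (fun y' ↦ metricCoeff y₀ y' i j) y :=
  SmoothAt.inner (smoothFieldAt_coordVec hy i) (smoothFieldAt_coordVec hy j)

/-- The connection along `φ` is compatible with the metric. -/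
theorem mvfderiv_inner {φ : M → N} {σ ρ : ∀ x : M, TangentSpace (𝓡 n) (φ x)} {x : M}
    (hσ : SmoothAt (m := m) φ σ x) (hρ : SmoothAt (m := m) φ ρ x) (v : TangentSpace (𝓡 m) x) :
    mvfderiv (𝓡 m) (fun x' ↦ inner ℝ (σ x') (ρ x')) x v =
      inner ℝ (covAlong φ σ x v) (ρ x) + inner ℝ (σ x) (covAlong φ ρ x v) := by
  have hx := mem_chartDomain_self (n := n) (φ x)
  have hE (i : Fin n) : SmoothAt (m := m) φ (fun x' ↦ coordVec (φ x) i (φ x')) x :=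
    SmoothFieldAt.comp (smoothFieldAt_coordVec hx i) hσ.base
  -- Expanding one argument in the frame reduces it to coordinate fields; applying this once to each
  -- argument, with `swap` in between, leaves only the derivative of g_{ij} at the chart centre.
  have step : ∀ {σ ρ : ∀ x : M, TangentSpace (𝓡 n) (φ x)}, SmoothAt (m := m) φ σ x →
      SmoothAt (m := m) φ ρ x →
      (∀ i, mvfderiv (𝓡 m) (fun x' ↦ inner ℝ (σ x') (coordVec (φ x) i (φ x'))) x v =
        inner ℝ (covAlong φ σ x v) (coordVec (φ x) i (φ x)) +
        inner ℝ (σ x) (covAlong φ (fun x' ↦ coordVec (φ x) i (φ x')) x v)) →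
      mvfderiv (𝓡 m) (fun x' ↦ inner ℝ (σ x') (ρ x')) x v =
        inner ℝ (covAlong φ σ x v) (ρ x) + inner ℝ (σ x) (covAlong φ ρ x v) := by
    intro σ ρ hσ hρ h
    have he := eventually_eq_sum_coordVec ρ hρ.base.continuousAt hx
    rw [covAlong_congr he, he.self_of_nhds, mvfderiv_congr (he.mono fun x' hx' ↦ by rw [hx'])]
    exact mvfderiv_inner_sum_smul hσ (fun i _ ↦ hρ.coord hx i) (fun i _ ↦ hE i) fun i _ ↦ h i
  have swap : ∀ {σ ρ : ∀ x : M, TangentSpace (𝓡 n) (φ x)},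
      mvfderiv (𝓡 m) (fun x' ↦ inner ℝ (σ x') (ρ x')) x v =
        inner ℝ (covAlong φ σ x v) (ρ x) + inner ℝ (σ x) (covAlong φ ρ x v) →
      mvfderiv (𝓡 m) (fun x' ↦ inner ℝ (ρ x') (σ x')) x v =
        inner ℝ (covAlong φ ρ x v) (σ x) + inner ℝ (ρ x) (covAlong φ σ x v) := by
    intro σ ρ h
    rw [real_inner_comm, real_inner_comm _ (ρ x), add_comm, ← h]
    simp only [real_inner_comm]
  refine step hσ hρ fun i ↦ swap <| step (hE i) hσ fun j ↦ ?_
  rw [covAlong_comp hσ.base (smoothFieldAt_coordVec hx i),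
    covAlong_comp hσ.base (smoothFieldAt_coordVec hx j), ← mvfderiv_metricCoeff]
  exact mvfderiv_fun_comp_apply (smoothFunAt_metricCoeff hx i j) hσ.base v

end Metric

/-! ### Commuting partial derivatives and vanishing brackets of coordinate-constant fields. -/

section Commuting

variable {n : ℕ}
  {N : Type*} [TopologicalSpace N] [ChartedSpace (EuclideanSpace ℝ (Fin n)) N]

lemma mvfderiv_comp_fderiv {g : EuclideanSpace ℝ (Fin n) → ℝ} {ψ : N → EuclideanSpace ℝ (Fin n)}
    {y : N} (hg : DifferentiableAt ℝ g (ψ y))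
    (hψ : MDifferentiableAt (𝓡 n) 𝓘(ℝ, EuclideanSpace ℝ (Fin n)) ψ y)
    (v : TangentSpace (𝓡 n) y) :
    mvfderiv (𝓡 n) (fun y' ↦ g (ψ y')) y v = fderiv ℝ g (ψ y) (mvfderiv (𝓡 n) ψ y v) := by
  refine (mvfderiv_comp_apply (g := g) y hg.mdifferentiableAt hψ v).trans ?_
  rw [mvfderiv, mfderiv_eq_fderiv]
  rfl

variable [IsManifold (𝓡 n) ∞ N]

lemma mvfderiv_extChartAt {y₀ y : N} (hy : y ∈ chartDomain (n := n) y₀)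
    (v : TangentSpace (𝓡 n) y) :
    mvfderiv (𝓡 n) (extChartAt (𝓡 n) y₀) y v =
      (trivializationAt (EuclideanSpace ℝ (Fin n)) (TangentSpace (𝓡 n)) y₀).continuousLinearMapAt
        ℝ y v := by
  rw [TangentBundle.continuousLinearMapAt_trivializationAt hy]
  rfl

lemma mvfderiv_extChartAt_coordVec {y₀ y : N} (hy : y ∈ chartDomain (n := n) y₀) (i : Fin n) :
    mvfderiv (𝓡 n) (extChartAt (𝓡 n) y₀) y (coordVec y₀ i y) =
      EuclideanSpace.single i (1 : ℝ) := by
  rw [mvfderiv_extChartAt hy, coordVec]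
  exact Trivialization.continuousLinearMapAt_symmL _ hy _

lemma smoothAt_comp_extChartAt_symm {f : N → ℝ} {y₀ y : N} (hy : y ∈ chartDomain (n := n) y₀)
    (hf : SmoothFunAt (m := n) f y) :
    ContDiffAt ℝ ∞ (f ∘ (extChartAt (𝓡 n) y₀).symm) (extChartAt (𝓡 n) y₀ y) := by
  have hy' : y ∈ (extChartAt (𝓡 n) y₀).source := by rwa [extChartAt_source]
  have h1 : ContMDiffAt 𝓘(ℝ, EuclideanSpace ℝ (Fin n)) (𝓡 n) ∞ (extChartAt (𝓡 n) y₀).symm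
      (extChartAt (𝓡 n) y₀ y) :=
    (contMDiffOn_extChartAt_symm y₀).contMDiffAt
      ((isOpen_extChartAt_target y₀).mem_nhds ((extChartAt (𝓡 n) y₀).map_source hy'))
  have h2 : ContMDiffAt (𝓡 n) 𝓘(ℝ) ∞ f
      ((extChartAt (𝓡 n) y₀).symm (extChartAt (𝓡 n) y₀ y)) := by
    rwa [(extChartAt (𝓡 n) y₀).left_inv hy']
  exact contMDiffAt_iff_contDiffAt.1 (h2.comp _ h1)

/-- Derivatives along coordinate fields are partial derivatives in the chart. -/
lemma mvfderiv_coordVec {f : N → ℝ} {y₀ y : N} (hy : y ∈ chartDomain (n := n) y₀)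
    (hf : SmoothFunAt (m := n) f y) (i : Fin n) :
    mvfderiv (𝓡 n) f y (coordVec y₀ i y) =
      fderiv ℝ (f ∘ (extChartAt (𝓡 n) y₀).symm) (extChartAt (𝓡 n) y₀ y)
        (EuclideanSpace.single i 1) := by
  have he : ∀ᶠ y' in 𝓝 y, f y' =
      (f ∘ (extChartAt (𝓡 n) y₀).symm) (extChartAt (𝓡 n) y₀ y') := by
    filter_upwards [chartDomain_mem_nhds hy] with y' hy'
    rw [Function.comp_apply, (extChartAt (𝓡 n) y₀).left_inv (by rwa [extChartAt_source])]
  have hF := (smoothAt_comp_extChartAt_symm hy hf).differentiableAt (by simp)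
  rw [mvfderiv_congr he, mvfderiv_comp_fderiv hF (mdifferentiableAt_extChartAt hy),
    mvfderiv_extChartAt_coordVec hy]

/-- Partial derivatives commute. -/
lemma mvfderiv_coordVec_comm {f : N → ℝ} {y₀ y : N} (hy : y ∈ chartDomain (n := n) y₀)
    (hf : ∀ᶠ y' in 𝓝 y, SmoothFunAt (m := n) f y') (i j : Fin n) :
    mvfderiv (𝓡 n) (fun y' ↦ mvfderiv (𝓡 n) f y' (coordVec y₀ j y')) y (coordVec y₀ i y) =
      mvfderiv (𝓡 n) (fun y' ↦ mvfderiv (𝓡 n) f y' (coordVec y₀ i y')) y (coordVec y₀ j y) := by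
  set F := f ∘ (extChartAt (𝓡 n) y₀).symm with hFdef
  set z := extChartAt (𝓡 n) y₀ y with hz
  have hF : ContDiffAt ℝ ∞ F z := smoothAt_comp_extChartAt_symm hy hf.self_of_nhds
  have hF' : ContDiffAt ℝ ∞ (fderiv ℝ F) z := hF.fderiv_right (by simp)
  have hd := hF'.differentiableAt (by simp)
  -- In the chart the iterated derivative is the second Fréchet derivative of `F` on two constant
  -- vectors, whose symmetry finishes the proof.
  have key (i j : Fin n) :
      mvfderiv (𝓡 n) (fun y' ↦ mvfderiv (𝓡 n) f y' (coordVec y₀ j y')) y (coordVec y₀ i y) =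
        fderiv ℝ (fderiv ℝ F) z (EuclideanSpace.single i 1) (EuclideanSpace.single j 1) := by
    have he : ∀ᶠ y' in 𝓝 y, mvfderiv (𝓡 n) f y' (coordVec y₀ j y') =
        fderiv ℝ F (extChartAt (𝓡 n) y₀ y') (EuclideanSpace.single j 1) := by
      filter_upwards [chartDomain_mem_nhds hy, hf] with y' hy' hf'
      exact mvfderiv_coordVec hy' hf' j
    have hG : DifferentiableAt ℝ (fun z' ↦ fderiv ℝ F z' (EuclideanSpace.single j 1)) z :=
      hd.clm_apply (differentiableAt_const _)
    rw [mvfderiv_congr he, mvfderiv_comp_fderiv (ψ := extChartAt (𝓡 n) y₀) hG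
      (mdifferentiableAt_extChartAt hy), mvfderiv_extChartAt_coordVec hy, ← hz,
      fderiv_clm_apply hd (differentiableAt_const _)]
    simp
  rw [key, key]
  exact (hF.isSymmSndFDerivAt (by simpa using ENat.LEInfty.out)) _ _

/-- The coordinate forms are exact. This lets components with respect to one chart be differentiated
along the coordinate fields of another. -/
lemma coordForm_eq_mvfderiv {y₀ y : N} (hy : y ∈ chartDomain (n := n) y₀) (k : Fin n)
    (v : TangentSpace (𝓡 n) y) :
    coordForm y₀ k y v = mvfderiv (𝓡 n) (fun y' ↦ extChartAt (𝓡 n) y₀ y' k) y v := by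
  have h : DifferentiableAt ℝ (fun z : EuclideanSpace ℝ (Fin n) ↦ z k)
      (extChartAt (𝓡 n) y₀ y) := (EuclideanSpace.proj (𝕜 := ℝ) k).differentiableAt
  rw [mvfderiv_comp_fderiv (ψ := extChartAt (𝓡 n) y₀) h (mdifferentiableAt_extChartAt hy),
    mvfderiv_extChartAt hy]
  change _ = fderiv ℝ (EuclideanSpace.proj (𝕜 := ℝ) k) _ _
  rw [ContinuousLinearMap.fderiv]
  rfl

/-- The constant vector field on the model space. -/
def constField (c : EuclideanSpace ℝ (Fin n)) (z : EuclideanSpace ℝ (Fin n)) :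
    TangentSpace 𝓘(ℝ, EuclideanSpace ℝ (Fin n)) z := c

lemma mlieBracket_constField (c d : EuclideanSpace ℝ (Fin n)) :
    VectorField.mlieBracket 𝓘(ℝ, EuclideanSpace ℝ (Fin n)) (constField c) (constField d) = 0 := by
  rw [← VectorField.mlieBracketWithin_univ, VectorField.mlieBracketWithin_eq_lieBracketWithin]
  ext1 z
  have h : VectorField.lieBracketWithin ℝ (fun _ : EuclideanSpace ℝ (Fin n) ↦ c) (fun _ ↦ d)
      Set.univ z = 0 := by
    simp [VectorField.lieBracketWithin]
  exact h

lemma mdifferentiableAt_constField (c z : EuclideanSpace ℝ (Fin n)) :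
    MDifferentiableAt 𝓘(ℝ, EuclideanSpace ℝ (Fin n)) 𝓘(ℝ, EuclideanSpace ℝ (Fin n)).tangent
      (fun z ↦ (⟨z, constField c z⟩ :
        TangentBundle 𝓘(ℝ, EuclideanSpace ℝ (Fin n)) (EuclideanSpace ℝ (Fin n)))) z :=
  (contMDiffAt_vectorSpace_iff_contDiffAt (n := 1) (V := constField c)).2
    (contDiffAt_const (c := c)) |>.mdifferentiableAt one_ne_zero

/-- The trivialization is the differential of the chart, so constant components mean being the
pull-back of a constant field on the model space. -/
lemma extension_eventuallyEq_mpullback (y : N) (w : TangentSpace (𝓡 n) y) :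
    extension y w =ᶠ[𝓝 y]
      VectorField.mpullback (𝓡 n) 𝓘(ℝ, EuclideanSpace ℝ (Fin n)) (extChartAt (𝓡 n) y)
        (constField ((trivializationAt (EuclideanSpace ℝ (Fin n)) (TangentSpace (𝓡 n))
          y).continuousLinearMapAt ℝ y w)) := by
  have hy := mem_chartDomain_self (n := n) y
  filter_upwards [chartDomain_mem_nhds hy] with y' hy'
  set T := trivializationAt (EuclideanSpace ℝ (Fin n)) (TangentSpace (𝓡 n)) y
  have he : extension y w y' = T.symmL ℝ y' (T.continuousLinearMapAt ℝ y w) := by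
    rw [Trivialization.symmL_apply _ hy',
      Trivialization.continuousLinearMapAt_apply_of_mem ℝ _ hy]
    rfl
  let A : TangentSpace (𝓡 n) y' ≃L[ℝ]
      TangentSpace 𝓘(ℝ, EuclideanSpace ℝ (Fin n)) (extChartAt (𝓡 n) y y') :=
    T.continuousLinearEquivAt ℝ y' hy'
  have hd : mfderiv (𝓡 n) 𝓘(ℝ, EuclideanSpace ℝ (Fin n)) (extChartAt (𝓡 n) y) y' = A := by
    rw [← TangentBundle.continuousLinearMapAt_trivializationAt hy']
    exact (Trivialization.coe_continuousLinearEquivAt_eq' _ hy').symm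
  rw [VectorField.mpullback_apply, he, hd]
  rw [ContinuousLinearMap.inverse_equiv]
  exact (congrFun (Trivialization.symm_continuousLinearEquivAt_eq (R := ℝ) T hy') _).symm

/-- Pull-back commutes with the Lie bracket, and constant fields commute. Hence the bracket term in
`curvature` drops out. -/
lemma mlieBracket_extension (y : N) (u v : TangentSpace (𝓡 n) y) :
    VectorField.mlieBracket (𝓡 n) (extension y u) (extension y v) y = 0 := by
  have hy := mem_chartDomain_self (n := n) y
  have : IsManifold (𝓡 n) (minSmoothness ℝ 2) N := by
    rw [minSmoothness_of_isRCLikeNormedField]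
    infer_instance
  rw [(extension_eventuallyEq_mpullback y u).mlieBracket_vectorField_eq
    (extension_eventuallyEq_mpullback y v),
    ← VectorField.mpullback_mlieBracket (n := ∞) (mdifferentiableAt_constField _ _)
      (mdifferentiableAt_constField _ _) (contMDiffAt_extChartAt' hy)
      (by simpa using ENat.LEInfty.out),
    mlieBracket_constField]
  simp [VectorField.mpullback_apply]

end Commuting

/-! ### Smoothness of covariant derivatives, via the Christoffel formula in a fixed chart. -/

section Smoothness

variable {m n : ℕ}
  {M : Type*} [TopologicalSpace M] [ChartedSpace (EuclideanSpace ℝ (Fin m)) M]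

lemma SmoothFunAt.add {f g : M → ℝ} {x : M} (hf : SmoothFunAt (m := m) f x)
    (hg : SmoothFunAt (m := m) g x) : SmoothFunAt (m := m) (fun x' ↦ f x' + g x') x :=
  ContMDiffAt.add hf hg

lemma SmoothFunAt.sub {f g : M → ℝ} {x : M} (hf : SmoothFunAt (m := m) f x)
    (hg : SmoothFunAt (m := m) g x) : SmoothFunAt (m := m) (fun x' ↦ f x' - g x') x :=
  ContMDiffAt.sub hf hg

lemma SmoothFunAt.sum {ι : Type*} {s : Finset ι} {f : ι → M → ℝ} {x : M}
    (hf : ∀ a ∈ s, SmoothFunAt (m := m) (f a) x) :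
    SmoothFunAt (m := m) (fun x' ↦ ∑ a ∈ s, f a x') x :=
  ContMDiffAt.sum hf

lemma SmoothFunAt.congr {f g : M → ℝ} {x : M} (hf : SmoothFunAt (m := m) f x)
    (h : ∀ᶠ x' in 𝓝 x, g x' = f x') : SmoothFunAt (m := m) g x :=
  ContMDiffAt.congr_of_eventuallyEq hf h

lemma SmoothFunAt.det {k : ℕ} {A : M → Matrix (Fin k) (Fin k) ℝ} {x : M}
    (hA : ∀ i j, SmoothFunAt (m := m) (fun x' ↦ A x' i j) x) :
    SmoothFunAt (m := m) (fun x' ↦ (A x').det) x := by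
  simp only [Matrix.det_apply']
  exact SmoothFunAt.sum fun σ _ ↦ SmoothFunAt.mul contMDiffAt_const
    (contMDiffAt_finsetProd fun i _ ↦ hA _ _)

/-- Cramer's rule: an entry of the inverse is the determinant of a row-replaced matrix divided by
the nonvanishing `(A x).det`. -/
lemma SmoothFunAt.matrix_inv {k : ℕ} {A : M → Matrix (Fin k) (Fin k) ℝ} {x : M}
    (hA : ∀ i j, SmoothFunAt (m := m) (fun x' ↦ A x' i j) x) (hdet : IsUnit (A x).det)
    (i j : Fin k) : SmoothFunAt (m := m) (fun x' ↦ (A x')⁻¹ i j) x := by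
  simp only [Matrix.inv_def, Matrix.smul_apply, Matrix.adjugate_apply, Ring.inverse_eq_inv',
    smul_eq_mul]
  refine SmoothFunAt.mul ((SmoothFunAt.det hA).inv₀ hdet.ne_zero) (SmoothFunAt.det fun a b ↦ ?_)
  by_cases ha : a = j
  · subst ha
    simp only [Matrix.updateRow_self]
    exact contMDiffAt_const
  · simp only [Matrix.updateRow_ne ha]
    exact hA a b

lemma smoothFunAt_mvfderiv [IsManifold (𝓡 m) ∞ M] {f : M → ℝ}
    {V : ∀ x : M, TangentSpace (𝓡 m) x} {x : M}
    (hf : ∀ᶠ x' in 𝓝 x, SmoothFunAt (m := m) f x') (hV : SmoothFieldAt V x) :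
    SmoothFunAt (m := m) (fun x' ↦ mvfderiv (𝓡 m) f x' (V x')) x := by
  have hx := mem_chartDomain_self (n := m) x
  have he : ∀ᶠ x' in 𝓝 x, mvfderiv (𝓡 m) f x' (V x') =
      ∑ i, coordForm x i x' (V x') *
        fderiv ℝ (f ∘ (extChartAt (𝓡 m) x).symm) (extChartAt (𝓡 m) x x')
          (EuclideanSpace.single i 1) := by
    filter_upwards [hf, chartDomain_mem_nhds hx] with x' hf' hx'
    conv_lhs => rw [← sum_coordForm_smul_coordVec hx' (V x'), map_sum]
    refine Finset.sum_congr rfl fun i _ ↦ ?_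
    rw [map_smul, smul_eq_mul, mvfderiv_coordVec hx' hf']
  refine SmoothFunAt.congr (SmoothFunAt.sum fun i _ ↦ SmoothFunAt.mul
    (SmoothAt.coord (φ := fun x' : M ↦ x') hV hx i) ?_) he
  have hF : ContDiffAt ℝ ∞ (fun z ↦ fderiv ℝ (f ∘ (extChartAt (𝓡 m) x).symm) z
      (EuclideanSpace.single i 1)) (extChartAt (𝓡 m) x x) :=
    ((smoothAt_comp_extChartAt_symm hx hf.self_of_nhds).fderiv_right (by simp)).clm_apply
      contDiffAt_const
  exact hF.contMDiffAt.comp x (contMDiffAt_extChartAt' hx)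

variable {N : Type*} [TopologicalSpace N] [ChartedSpace (EuclideanSpace ℝ (Fin n)) N]
  [IsManifold (𝓡 n) ∞ N]

lemma smoothFunAt_extChartAt {y₀ y : N} (hy : y ∈ chartDomain (n := n) y₀) (k : Fin n) :
    SmoothFunAt (m := n) (fun y' ↦ extChartAt (𝓡 n) y₀ y' k) y :=
  ((EuclideanSpace.proj (𝕜 := ℝ) k).contDiff.contMDiff.contMDiffAt
    (x := extChartAt (𝓡 n) y₀ y)).comp y (contMDiffAt_extChartAt' hy)

lemma eventually_smoothFunAt_extChartAt {y₀ y : N} (hy : y ∈ chartDomain (n := n) y₀)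
    (k : Fin n) : ∀ᶠ y' in 𝓝 y, SmoothFunAt (m := n) (fun y' ↦ extChartAt (𝓡 n) y₀ y' k) y' :=
  mem_of_superset (chartDomain_mem_nhds hy) fun _ h ↦ smoothFunAt_extChartAt h k

/-- The k-th component of dφ(V) is the derivative along V of the k-th coordinate of φ. -/
lemma SmoothAt.mfderiv [IsManifold (𝓡 m) ∞ M] {φ : M → N} {V : ∀ x : M, TangentSpace (𝓡 m) x}
    {x : M} (hφ : ∀ᶠ x' in 𝓝 x, ContMDiffAt (𝓡 m) (𝓡 n) ∞ φ x') (hV : SmoothFieldAt V x) :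
    SmoothAt (m := m) φ (fun x' ↦ mfderiv (𝓡 m) (𝓡 n) φ x' (V x')) x := by
  have hx := mem_chartDomain_self (n := n) (φ x)
  have hφx := hφ.self_of_nhds
  have hmem := hφx.continuousAt.eventually (chartDomain_mem_nhds hx)
  have hs (k : Fin n) {x' : M} (h1 : ContMDiffAt (𝓡 m) (𝓡 n) ∞ φ x')
      (h2 : φ x' ∈ chartDomain (n := n) (φ x)) :
      SmoothFunAt (m := m) (fun x' ↦ extChartAt (𝓡 n) (φ x) (φ x') k) x' :=
    ContMDiffAt.comp x' (smoothFunAt_extChartAt h2 k) h1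
  refine (smoothAt_iff hx).2 ⟨hφx, fun k ↦ ?_⟩
  refine (smoothFunAt_mvfderiv (f := fun x' ↦ extChartAt (𝓡 n) (φ x) (φ x') k) (V := V)
    (hφ.mp (hmem.mono fun x' h2 h1 ↦ hs k h1 h2)) hV).congr ?_
  filter_upwards [hφ, hmem] with x' h1 h2
  rw [coordForm_eq_mvfderiv h2]
  exact (mvfderiv_fun_comp_apply (smoothFunAt_extChartAt h2 k) h1 _).symm

variable [RiemannianBundle (fun y : N ↦ TangentSpace (𝓡 n) y)]

lemma coordForm_leviCivita (Y : ∀ y : N, TangentSpace (𝓡 n) y) (y : N)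
    (v : TangentSpace (𝓡 n) y) (k : Fin n) :
    coordForm y k y (leviCivita Y y v) =
      mvfderiv (𝓡 n) (fun y' ↦ coordForm y k y' (Y y')) y v +
      ∑ i, ∑ j, christoffel y y k i j * coordForm y i y v * coordForm y j y (Y y) := by
  have hid : mfderiv (𝓡 n) (𝓡 n) (fun y' : N ↦ y') y = ContinuousLinearMap.id ℝ _ := mfderiv_id
  have := coordForm_covAlong (fun y' : N ↦ y') Y y v k
  rw [hid] at this
  exact this

/-- Coordinate fields satisfy `∇_{∂_i} ∂_j = ∇_{∂_j} ∂_i` throughout the chart. -/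
lemma leviCivita_coordVec_comm {y₀ y : N} (hy : y ∈ chartDomain (n := n) y₀) (i j : Fin n) :
    leviCivita (coordVec y₀ j) y (coordVec y₀ i y) =
      leviCivita (coordVec y₀ i) y (coordVec y₀ j y) := by
  have hyy := mem_chartDomain_self (n := n) y
  -- The fields belong to the chart at `y₀`, but the connection at `y` uses the chart at `y`. By
  -- exactness the components are first partials of the coordinate functions y^k, so the derivative
  -- terms agree as mixed second partials and the Christoffel terms by symmetry in the lower
  -- indices.
  have hc (j k : Fin n) : ∀ᶠ y' in 𝓝 y, coordForm y k y' (coordVec y₀ j y') =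
      mvfderiv (𝓡 n) (fun y' ↦ extChartAt (𝓡 n) y y' k) y' (coordVec y₀ j y') := by
    filter_upwards [chartDomain_mem_nhds hyy] with y' hy'
    exact coordForm_eq_mvfderiv hy' k _
  refine ext_coordForm hyy fun k ↦ ?_
  rw [coordForm_leviCivita, coordForm_leviCivita, mvfderiv_congr (hc j k), mvfderiv_congr (hc i k),
    mvfderiv_coordVec_comm hy (eventually_smoothFunAt_extChartAt hyy k), Finset.sum_comm]
  congr 1
  refine Finset.sum_congr rfl fun a _ ↦ Finset.sum_congr rfl fun b _ ↦ ?_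
  rw [christoffel_comm]
  ring

lemma ext_inner_coordVec {y₀ y : N} (hy : y ∈ chartDomain (n := n) y₀)
    {u v : TangentSpace (𝓡 n) y}
    (h : ∀ i, inner ℝ u (coordVec y₀ i y) = inner ℝ v (coordVec y₀ i y)) : u = v := by
  refine ext_inner_right ℝ fun w ↦ ?_
  rw [← sum_coordForm_smul_coordVec hy w, inner_sum, inner_sum]
  simp only [real_inner_smul_right, h]

variable [IsContMDiffRiemannianBundle (𝓡 n) ∞ (EuclideanSpace ℝ (Fin n))
  (fun y : N ↦ TangentSpace (𝓡 n) y)]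

lemma metricCoeffDeriv_eq {y₀ y : N} (hy : y ∈ chartDomain (n := n) y₀) (l i j : Fin n) :
    metricCoeffDeriv y₀ y l i j =
      inner ℝ (leviCivita (coordVec y₀ i) y (coordVec y₀ l y)) (coordVec y₀ j y) +
      inner ℝ (coordVec y₀ i y) (leviCivita (coordVec y₀ j) y (coordVec y₀ l y)) :=
  mvfderiv_inner (φ := fun y' : N ↦ y') (smoothFieldAt_coordVec hy i)
    (smoothFieldAt_coordVec hy j) (coordVec y₀ l y)

/-- The usual Koszul argument, now available away from the centre: metric compatibility expands each
derivative of g, and symmetry of the connection cancels the unwanted terms. -/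
lemma inner_leviCivita_coordVec {y₀ y : N} (hy : y ∈ chartDomain (n := n) y₀) (i j l : Fin n) :
    inner ℝ (leviCivita (coordVec y₀ j) y (coordVec y₀ i y)) (coordVec y₀ l y) =
      (1 / 2) * (metricCoeffDeriv y₀ y i j l + metricCoeffDeriv y₀ y j i l -
        metricCoeffDeriv y₀ y l i j) := by
  rw [metricCoeffDeriv_eq hy, metricCoeffDeriv_eq hy, metricCoeffDeriv_eq hy,
    leviCivita_coordVec_comm hy j i, leviCivita_coordVec_comm hy l i,
    leviCivita_coordVec_comm hy l j,
    real_inner_comm (leviCivita (coordVec y₀ l) y (coordVec y₀ i y)) (coordVec y₀ j y)]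
  ring

/-- The formula for the Levi-Civita connection in any chart of the preferred atlas. -/
lemma leviCivita_coordVec {y₀ y : N} (hy : y ∈ chartDomain (n := n) y₀) (i j : Fin n) :
    leviCivita (coordVec y₀ j) y (coordVec y₀ i y) =
      ∑ k, christoffel y₀ y k i j • coordVec y₀ k y := by
  refine ext_inner_coordVec hy fun l ↦ ?_
  rw [inner_leviCivita_coordVec hy, sum_inner, ← sum_christoffel_mul_metricCoeff hy]
  simp only [real_inner_smul_left]
  rfl

lemma smoothFunAt_christoffel {y₀ y : N} (hy : y ∈ chartDomain (n := n) y₀) (k i j : Fin n) :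
    SmoothFunAt (m := n) (fun y' ↦ christoffel y₀ y' k i j) y := by
  have hd (l i j : Fin n) : SmoothFunAt (m := n) (fun y' ↦ metricCoeffDeriv y₀ y' l i j) y :=
    smoothFunAt_mvfderiv (mem_of_superset (chartDomain_mem_nhds hy) fun _ h ↦
      smoothFunAt_metricCoeff h i j) (smoothFieldAt_coordVec hy l)
  simp only [christoffel]
  refine SmoothFunAt.mul contMDiffAt_const (SmoothFunAt.sum fun l _ ↦ SmoothFunAt.mul ?_
    (((hd _ _ _).add (hd _ _ _)).sub (hd _ _ _)))
  exact SmoothFunAt.matrix_inv (fun a b ↦ smoothFunAt_metricCoeff hy a b)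
    (isUnit_det_metricCoeff hy) k l

lemma smoothFieldAt_leviCivita_coordVec {y₀ y : N} (hy : y ∈ chartDomain (n := n) y₀)
    (i j : Fin n) :
    SmoothFieldAt (fun y' ↦ leviCivita (coordVec y₀ j) y' (coordVec y₀ i y')) y := by
  refine SmoothAt.congr (σ := fun y' ↦ ∑ k, christoffel y₀ y' k i j • coordVec y₀ k y')
    (SmoothAt.sum contMDiffAt_id fun k _ ↦
      SmoothAt.smul (smoothFunAt_christoffel hy k i j) (smoothFieldAt_coordVec hy k)) ?_
  filter_upwards [chartDomain_mem_nhds hy] with y' hy'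
  exact leviCivita_coordVec hy' i j

omit [IsContMDiffRiemannianBundle (𝓡 n) ∞ (EuclideanSpace ℝ (Fin n))
  (fun y : N ↦ TangentSpace (𝓡 n) y)] in
lemma covAlong_sum_smul_comp {ι : Type*} {s : Finset ι} {φ : M → N} {f : ι → M → ℝ}
    {Y : ι → ∀ y : N, TangentSpace (𝓡 n) y} {x : M} (hφ : ContMDiffAt (𝓡 m) (𝓡 n) ∞ φ x)
    (hf : ∀ a ∈ s, SmoothFunAt (m := m) (f a) x) (hY : ∀ a ∈ s, SmoothFieldAt (Y a) (φ x))
    (v : TangentSpace (𝓡 m) x) :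
    covAlong φ (fun x' ↦ ∑ a ∈ s, f a x' • Y a (φ x')) x v =
      ∑ a ∈ s, (mvfderiv (𝓡 m) (f a) x v • Y a (φ x) +
        f a x • leviCivita (Y a) (φ x) (mfderiv (𝓡 m) (𝓡 n) φ x v)) := by
  rw [covAlong_sum fun a ha ↦ SmoothAt.smul (hf a ha) (SmoothFieldAt.comp (hY a ha) hφ)]
  refine Finset.sum_congr rfl fun a ha ↦ ?_
  rw [covAlong_smul (hf a ha) (SmoothFieldAt.comp (hY a ha) hφ), covAlong_comp hφ (hY a ha)]

omit [IsContMDiffRiemannianBundle (𝓡 n) ∞ (EuclideanSpace ℝ (Fin n))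
  (fun y : N ↦ TangentSpace (𝓡 n) y)] in
-- Here the frame is fixed while `x` may move, unlike in the definition of `covAlong`; smoothness in
-- `x` is read off from this expression.
lemma covAlong_eq_sum_coordVec {φ : M → N} {σ : ∀ x : M, TangentSpace (𝓡 n) (φ x)} {x : M}
    {y₀ : N} (hσ : SmoothAt (m := m) φ σ x) (hx : φ x ∈ chartDomain (n := n) y₀)
    (v : TangentSpace (𝓡 m) x) :
    covAlong φ σ x v =
      ∑ i, (mvfderiv (𝓡 m) (fun x' ↦ coordForm y₀ i (φ x') (σ x')) x v • coordVec y₀ i (φ x) +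
        coordForm y₀ i (φ x) (σ x) •
          ∑ j, coordForm y₀ j (φ x) (mfderiv (𝓡 m) (𝓡 n) φ x v) •
            leviCivita (coordVec y₀ i) (φ x) (coordVec y₀ j (φ x))) := by
  rw [covAlong_congr (eventually_eq_sum_coordVec σ hσ.base.continuousAt hx),
    covAlong_sum_smul_comp hσ.base (fun i _ ↦ hσ.coord hx i)
      (fun i _ ↦ smoothFieldAt_coordVec hx i)]
  refine Finset.sum_congr rfl fun i _ ↦ ?_
  conv_lhs => rw [← sum_coordForm_smul_coordVec hx (mfderiv (𝓡 m) (𝓡 n) φ x v)]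
  simp only [leviCivita]
  rw [covAlong_map_sum]

/-- Covariant derivatives of smooth sections along smooth vector fields are smooth. -/
theorem SmoothAt.covAlong [IsManifold (𝓡 m) ∞ M] {φ : M → N}
    {σ : ∀ x : M, TangentSpace (𝓡 n) (φ x)} {V : ∀ x : M, TangentSpace (𝓡 m) x} {x : M}
    (hσ : ∀ᶠ x' in 𝓝 x, SmoothAt (m := m) φ σ x') (hV : SmoothFieldAt V x) :
    SmoothAt (m := m) φ (fun x' ↦ covAlong φ σ x' (V x')) x := by
  have hx := mem_chartDomain_self (n := n) (φ x)
  have hσx := hσ.self_of_nhds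
  have hφ : ∀ᶠ x' in 𝓝 x, ContMDiffAt (𝓡 m) (𝓡 n) ∞ φ x' := hσ.mono fun _ h ↦ h.base
  have hmem := hσx.base.continuousAt.eventually (chartDomain_mem_nhds hx)
  have hcoord (i : Fin n) : ∀ᶠ x' in 𝓝 x,
      SmoothFunAt (m := m) (fun x' ↦ coordForm (φ x) i (φ x') (σ x')) x' :=
    hσ.mp (hmem.mono fun x' h1 h2 ↦ h2.coord h1 i)
  refine (SmoothAt.sum (s := Finset.univ) hσx.base fun i _ ↦
    (SmoothAt.smul (smoothFunAt_mvfderiv (hcoord i) hV)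
      (SmoothFieldAt.comp (smoothFieldAt_coordVec hx i) hσx.base)).add
    (SmoothAt.smul (hσx.coord hx i) (SmoothAt.sum (s := Finset.univ) hσx.base fun j _ ↦
      SmoothAt.smul ((SmoothAt.mfderiv hφ hV).coord hx j)
      (SmoothFieldAt.comp (smoothFieldAt_leviCivita_coordVec hx j i) hσx.base)))).congr ?_
  filter_upwards [hσ, hmem] with x' h1 h2
  exact covAlong_eq_sum_coordVec h1 h2 (V x')

lemma SmoothFieldAt.leviCivita {Y V : ∀ y : N, TangentSpace (𝓡 n) y} {y : N}
    (hY : ∀ᶠ y' in 𝓝 y, SmoothFieldAt Y y') (hV : SmoothFieldAt V y) :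
    SmoothFieldAt (fun y' ↦ leviCivita Y y' (V y')) y :=
  SmoothAt.covAlong (φ := fun y' : N ↦ y') hY hV

end Smoothness

/-! ### Traces in coordinate frames; smoothness of the tension field and of the current. -/

section Traces

variable {m n : ℕ}
  {M : Type*} [TopologicalSpace M] [ChartedSpace (EuclideanSpace ℝ (Fin m)) M]
  [IsManifold (𝓡 m) ∞ M] [RiemannianBundle (fun x : M ↦ TangentSpace (𝓡 m) x)]

/-- Multiplying the left side by g produces the components of the orthonormal expansion of ∂_i, that
is, the identity matrix. The right side no longer sees the arbitrary choice of `onb`. -/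
lemma sum_coordForm_onb {x₀ x : M} (hx : x ∈ chartDomain (n := m) x₀) (i j : Fin m) :
    ∑ α, coordForm x₀ i x (onb x α) * coordForm x₀ j x (onb x α) =
      (Matrix.of (metricCoeff (n := m) x₀ x))⁻¹ i j := by
  set G := Matrix.of (metricCoeff (n := m) x₀ x) with hG
  set C : Matrix (Fin m) (Fin m) ℝ :=
    Matrix.of fun i j ↦ ∑ α, coordForm x₀ i x (onb x α) * coordForm x₀ j x (onb x α) with hC
  suffices h : G * C = 1 by
    rw [Matrix.inv_eq_right_inv h]
    rfl
  ext i j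
  have h1 (v w : TangentSpace (𝓡 m) x) :
      ∑ k, inner ℝ v (coordVec x₀ k x) * coordForm x₀ k x w = inner ℝ v w := by
    conv_rhs => rw [← sum_coordForm_smul_coordVec hx w, inner_sum]
    exact Finset.sum_congr rfl fun k _ ↦ by rw [real_inner_smul_right, mul_comm]
  calc (G * C) i j = ∑ k, ∑ α, inner ℝ (coordVec x₀ i x) (coordVec x₀ k x) *
        (coordForm x₀ k x (onb x α) * coordForm x₀ j x (onb x α)) := by
        rw [Matrix.mul_apply]
        exact Finset.sum_congr rfl fun k _ ↦ by rw [hC, Matrix.of_apply, Finset.mul_sum]; rfl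
    _ = ∑ α, inner ℝ (coordVec x₀ i x) (onb x α) * coordForm x₀ j x (onb x α) := by
        rw [Finset.sum_comm]
        refine Finset.sum_congr rfl fun α _ ↦ ?_
        rw [← h1, Finset.sum_mul]
        exact Finset.sum_congr rfl fun k _ ↦ by ring
    _ = coordForm x₀ j x (∑ α, inner ℝ (onb x α) (coordVec x₀ i x) • onb x α) := by
        rw [coordForm_sum]
        exact Finset.sum_congr rfl fun α _ ↦ by rw [coordForm_smul, real_inner_comm]
    _ = (1 : Matrix (Fin m) (Fin m) ℝ) i j := by
        rw [OrthonormalBasis.sum_repr', coordForm_coordVec hx, Matrix.one_apply]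
        simp only [eq_comm]

/-- The metric trace in terms of a coordinate frame. -/
lemma metricTrace_eq_sum {W : Type*} [AddCommGroup W] [Module ℝ W] {x₀ x : M}
    (hx : x ∈ chartDomain (n := m) x₀)
    (B : TangentSpace (𝓡 m) x →ₗ[ℝ] TangentSpace (𝓡 m) x →ₗ[ℝ] W) :
    metricTrace x (fun v w ↦ B v w) = ∑ i, ∑ j,
      (Matrix.of (metricCoeff (n := m) x₀ x))⁻¹ i j • B (coordVec x₀ i x) (coordVec x₀ j x) := by
  have h (v : TangentSpace (𝓡 m) x) : B v v = ∑ i, ∑ j,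
      (coordForm x₀ i x v * coordForm x₀ j x v) • B (coordVec x₀ i x) (coordVec x₀ j x) := by
    conv_lhs => rw [← sum_coordForm_smul_coordVec hx v]
    simp only [map_sum, map_smul, LinearMap.sum_apply, LinearMap.smul_apply, Finset.smul_sum,
      smul_smul]
    rw [Finset.sum_comm]
    simp only [mul_comm]
  simp only [metricTrace, h, ← sum_coordForm_onb hx, Finset.sum_smul]
  rw [Finset.sum_comm]
  refine Finset.sum_congr rfl fun i _ ↦ ?_
  rw [Finset.sum_comm]

variable {N : Type*} [TopologicalSpace N] [ChartedSpace (EuclideanSpace ℝ (Fin n)) N]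
  [IsManifold (𝓡 n) ∞ N] [RiemannianBundle (fun y : N ↦ TangentSpace (𝓡 n) y)]

omit [IsManifold (𝓡 m) ∞ M] [RiemannianBundle (fun x : M ↦ TangentSpace (𝓡 m) x)] in
lemma covAlong_sum_smul {ι : Type*} {s : Finset ι} {φ : M → N} {f : ι → M → ℝ}
    {σ : ι → ∀ x : M, TangentSpace (𝓡 n) (φ x)} {x : M}
    (hf : ∀ a ∈ s, SmoothFunAt (m := m) (f a) x) (hσ : ∀ a ∈ s, SmoothAt (m := m) φ (σ a) x)
    (v : TangentSpace (𝓡 m) x) :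
    covAlong φ (fun x' ↦ ∑ a ∈ s, f a x' • σ a x') x v =
      ∑ a ∈ s, (mvfderiv (𝓡 m) (f a) x v • σ a x + f a x • covAlong φ (σ a) x v) := by
  rw [covAlong_sum fun a ha ↦ SmoothAt.smul (hf a ha) (hσ a ha)]
  exact Finset.sum_congr rfl fun a ha ↦ covAlong_smul (hf a ha) (hσ a ha) v

/-- The expression `∇_v (dφ(W)) - dφ(∇_v W)`, which is tensorial in `W`. -/
noncomputable def hessianField (φ : M → N) (W : ∀ x : M, TangentSpace (𝓡 m) x) (x : M)
    (v : TangentSpace (𝓡 m) x) : TangentSpace (𝓡 n) (φ x) :=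
  covAlong φ (fun x' ↦ mfderiv (𝓡 m) (𝓡 n) φ x' (W x')) x v
    - mfderiv (𝓡 m) (𝓡 n) φ x (leviCivita W x v)

/-- By the Leibniz rule both parts of `hessianField` contain the same derivatives of the components
of `W`; they cancel, so only the value of `W` at `x` matters. -/
lemma hessianField_eq_sum {φ : M → N} {W : ∀ x : M, TangentSpace (𝓡 m) x} {x : M}
    (hφ : ∀ᶠ x' in 𝓝 x, ContMDiffAt (𝓡 m) (𝓡 n) ∞ φ x') (hW : SmoothFieldAt W x)
    (v : TangentSpace (𝓡 m) x) :
    hessianField (m := m) (n := n) φ W x v =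
      ∑ i, coordForm x i x (W x) • hessianField (m := m) (n := n) φ (coordVec x i) x v := by
  have hx := mem_chartDomain_self (n := m) x
  have he := eventually_eq_sum_coordVec (φ := fun x' : M ↦ x') W continuousAt_id hx
  have hc (i : Fin m) := SmoothAt.coord (φ := fun x' : M ↦ x') hW hx i
  have h1 : covAlong φ (fun x' ↦ mfderiv (𝓡 m) (𝓡 n) φ x' (W x')) x v =
      ∑ i, (mvfderiv (𝓡 m) (fun x' ↦ coordForm x i x' (W x')) x v •
          mfderiv (𝓡 m) (𝓡 n) φ x (coordVec x i x) +
        coordForm x i x (W x) •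
          covAlong φ (fun x' ↦ mfderiv (𝓡 m) (𝓡 n) φ x' (coordVec x i x')) x v) := by
    rw [← covAlong_sum_smul (fun i _ ↦ hc i)
      (fun i _ ↦ SmoothAt.mfderiv hφ (smoothFieldAt_coordVec hx i))]
    refine covAlong_congr (he.mono fun x' hx' ↦ ?_) v
    conv_lhs => rw [hx']
    simp only [map_sum, map_smul]
  have h2 : leviCivita W x v =
      ∑ i, (mvfderiv (𝓡 m) (fun x' ↦ coordForm x i x' (W x')) x v • coordVec x i x +
        coordForm x i x (W x) • leviCivita (coordVec x i) x v) :=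
    (covAlong_congr he v).trans
      (covAlong_sum_smul (fun i _ ↦ hc i) (fun i _ ↦ smoothFieldAt_coordVec hx i) v)
  rw [hessianField, h1, h2, map_sum, ← Finset.sum_sub_distrib]
  refine Finset.sum_congr rfl fun i _ ↦ ?_
  rw [map_add, map_smul, map_smul, hessianField, smul_sub]
  abel

lemma hessian_eq_sum {φ : M → N} {x : M}
    (hφ : ∀ᶠ x' in 𝓝 x, ContMDiffAt (𝓡 m) (𝓡 n) ∞ φ x')
    (v w : TangentSpace (𝓡 m) x) :
    hessian (m := m) (n := n) φ x v w =
      ∑ i, coordForm x i x w • hessianField (m := m) (n := n) φ (coordVec x i) x v := by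
  have h := hessianField_eq_sum hφ (smoothFieldAt_extension w (mem_chartDomain_self x)) v
  rw [extension_self] at h
  exact h

/-- The second fundamental form can be computed with any extension of the second argument. -/
lemma hessian_eq {φ : M → N} {W : ∀ x : M, TangentSpace (𝓡 m) x} {x : M}
    (hφ : ∀ᶠ x' in 𝓝 x, ContMDiffAt (𝓡 m) (𝓡 n) ∞ φ x') (hW : SmoothFieldAt W x)
    (v : TangentSpace (𝓡 m) x) :
    hessian (m := m) (n := n) φ x v (W x) = hessianField (m := m) (n := n) φ W x v := by
  rw [hessian_eq_sum hφ, hessianField_eq_sum hφ hW]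

lemma hessianField_add (φ : M → N) (W : ∀ x : M, TangentSpace (𝓡 m) x) (x : M)
    (v v' : TangentSpace (𝓡 m) x) :
    hessianField (m := m) (n := n) φ W x (v + v') =
      hessianField (m := m) (n := n) φ W x v + hessianField (m := m) (n := n) φ W x v' := by
  simp only [hessianField, leviCivita]
  rw [covAlong_map_add, covAlong_map_add, map_add]
  abel

lemma hessianField_smul (φ : M → N) (W : ∀ x : M, TangentSpace (𝓡 m) x) (x : M)
    (c : ℝ) (v : TangentSpace (𝓡 m) x) :
    hessianField (m := m) (n := n) φ W x (c • v) = c • hessianField (m := m) (n := n) φ W x v := by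
  simp only [hessianField, leviCivita]
  rw [covAlong_map_smul, covAlong_map_smul, map_smul, smul_sub]

/-- The second fundamental form as a bilinear map. -/
noncomputable def hessianBilin {φ : M → N} {x : M}
    (hφ : ∀ᶠ x' in 𝓝 x, ContMDiffAt (𝓡 m) (𝓡 n) ∞ φ x') :
    TangentSpace (𝓡 m) x →ₗ[ℝ] TangentSpace (𝓡 m) x →ₗ[ℝ] TangentSpace (𝓡 n) (φ x) :=
  LinearMap.mk₂ ℝ (hessian (m := m) (n := n) φ x)
    (fun v v' w ↦ hessianField_add φ (extension x w) x v v')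
    (fun c v w ↦ hessianField_smul φ (extension x w) x c v)
    (fun v w w' ↦ by
      simp only [hessian_eq_sum hφ, coordForm_add, add_smul, Finset.sum_add_distrib])
    (fun c v w ↦ by
      simp only [hessian_eq_sum hφ, coordForm_smul, mul_smul, Finset.smul_sum])

lemma tension_eq_sum {φ : M → N} {x₀ x : M} (hx : x ∈ chartDomain (n := m) x₀)
    (hφ : ∀ᶠ x' in 𝓝 x, ContMDiffAt (𝓡 m) (𝓡 n) ∞ φ x') :
    tension (m := m) (n := n) φ x = ∑ i, ∑ j, (Matrix.of (metricCoeff (n := m) x₀ x))⁻¹ i j •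
      hessianField (m := m) (n := n) φ (coordVec x₀ j) x (coordVec x₀ i x) := by
  refine (metricTrace_eq_sum hx (hessianBilin hφ)).trans ?_
  refine Finset.sum_congr rfl fun i _ ↦ Finset.sum_congr rfl fun j _ ↦ ?_
  rw [← hessian_eq hφ (smoothFieldAt_coordVec hx j)]
  rfl

variable [IsContMDiffRiemannianBundle (𝓡 m) ∞ (EuclideanSpace ℝ (Fin m))
  (fun x : M ↦ TangentSpace (𝓡 m) x)]

lemma smoothFunAt_inv_metricCoeff {x₀ x : M} (hx : x ∈ chartDomain (n := m) x₀) (i j : Fin m) :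
    SmoothFunAt (m := m) (fun x' ↦ (Matrix.of (metricCoeff (n := m) x₀ x'))⁻¹ i j) x :=
  SmoothFunAt.matrix_inv (fun a b ↦ smoothFunAt_metricCoeff hx a b)
    (isUnit_det_metricCoeff hx) i j

variable [IsContMDiffRiemannianBundle (𝓡 n) ∞ (EuclideanSpace ℝ (Fin n))
  (fun y : N ↦ TangentSpace (𝓡 n) y)]

/-- The tension field of a smooth map is smooth. -/
theorem smoothAt_tension {φ : M → N} (hφ : ContMDiff (𝓡 m) (𝓡 n) ∞ φ) (x : M) :
    SmoothAt (m := m) φ (tension (m := m) (n := n) φ) x := by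
  have hx := mem_chartDomain_self (n := m) x
  have hφ' (x' : M) : ∀ᶠ x'' in 𝓝 x', ContMDiffAt (𝓡 m) (𝓡 n) ∞ φ x'' :=
    Eventually.of_forall fun x'' ↦ hφ x''
  have hE (i : Fin m) := eventually_smoothFieldAt_coordVec x i
  have hb (i j : Fin m) : SmoothAt (m := m) φ
      (fun x' ↦ hessianField (m := m) (n := n) φ (coordVec x j) x' (coordVec x i x')) x :=
    (SmoothAt.covAlong ((hE j).mono fun x' h ↦ SmoothAt.mfderiv (hφ' x') h)
      (smoothFieldAt_coordVec hx i)).sub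
    (SmoothAt.mfderiv (hφ' x) (SmoothFieldAt.leviCivita (hE j) (smoothFieldAt_coordVec hx i)))
  refine (SmoothAt.sum (s := Finset.univ) (hφ x) fun i _ ↦ SmoothAt.sum (s := Finset.univ) (hφ x)
    fun j _ ↦ SmoothAt.smul (smoothFunAt_inv_metricCoeff hx i j) (hb i j)).congr ?_
  filter_upwards [chartDomain_mem_nhds hx] with x' hx'
  exact tension_eq_sum hx' (hφ' x')

omit [IsContMDiffRiemannianBundle (𝓡 m) ∞ (EuclideanSpace ℝ (Fin m))
  (fun x : M ↦ TangentSpace (𝓡 m) x)] [IsContMDiffRiemannianBundle (𝓡 n) ∞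
  (EuclideanSpace ℝ (Fin n)) (fun y : N ↦ TangentSpace (𝓡 n) y)]

/-- The Noether form as a linear form. -/
noncomputable def noetherLinear (δ₁ δ₂ : ℝ) (φ : M → N) (X : ∀ y : N, TangentSpace (𝓡 n) y)
    (x : M) :
    TangentSpace (𝓡 m) x →ₗ[ℝ] ℝ where
  toFun := noetherForm (m := m) (n := n) δ₁ δ₂ φ X x
  map_add' v w := by
    simp only [noetherForm, covAlong_map_add, map_add, inner_add_left, inner_add_right]
    ring
  map_smul' c v := by
    simp only [noetherForm, covAlong_map_smul, map_smul, real_inner_smul_left,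
      real_inner_smul_right, RingHom.id_apply, smul_eq_mul]
    ring

/-- The current is the Riesz dual of a linear form, so it can be paired with any vector and not just
with `onb`; the divergence computation pairs it with an extended field. -/
lemma inner_noetherCurrent (δ₁ δ₂ : ℝ) (φ : M → N) (X : ∀ y : N, TangentSpace (𝓡 n) y) (x : M)
    (v : TangentSpace (𝓡 m) x) :
    inner ℝ (noetherCurrent (m := m) (n := n) δ₁ δ₂ φ X x) v =
      noetherForm (m := m) (n := n) δ₁ δ₂ φ X x v := by
  have h : noetherLinear (m := m) (n := n) δ₁ δ₂ φ X x v =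
      noetherForm (m := m) (n := n) δ₁ δ₂ φ X x v := rfl
  rw [← h, noetherCurrent, sum_inner]
  conv_rhs => rw [← OrthonormalBasis.sum_repr' (onb x) v, map_sum]
  refine Finset.sum_congr rfl fun α _ ↦ ?_
  rw [real_inner_smul_left, map_smul, smul_eq_mul, mul_comm]
  rfl

lemma noetherCurrent_eq_sum (δ₁ δ₂ : ℝ) (φ : M → N) (X : ∀ y : N, TangentSpace (𝓡 n) y)
    {x₀ x : M} (hx : x ∈ chartDomain (n := m) x₀) :
    noetherCurrent (m := m) (n := n) δ₁ δ₂ φ X x =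
      ∑ i, ∑ j, (Matrix.of (metricCoeff (n := m) x₀ x))⁻¹ i j •
      noetherForm (m := m) (n := n) δ₁ δ₂ φ X x (coordVec x₀ i x) • coordVec x₀ j x :=
  metricTrace_eq_sum hx ((noetherLinear (m := m) (n := n) δ₁ δ₂ φ X x).smulRight
    (LinearMap.id : TangentSpace (𝓡 m) x →ₗ[ℝ] TangentSpace (𝓡 m) x))

variable [IsContMDiffRiemannianBundle (𝓡 m) ∞ (EuclideanSpace ℝ (Fin m))
  (fun x : M ↦ TangentSpace (𝓡 m) x)] [IsContMDiffRiemannianBundle (𝓡 n) ∞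
  (EuclideanSpace ℝ (Fin n)) (fun y : N ↦ TangentSpace (𝓡 n) y)]

/-- The Noether current is smooth. -/
theorem smoothFieldAt_noetherCurrent (δ₁ δ₂ : ℝ) {φ : M → N} (hφ : ContMDiff (𝓡 m) (𝓡 n) ∞ φ)
    {X : ∀ y : N, TangentSpace (𝓡 n) y} (hX : ∀ y, SmoothFieldAt X y) (x : M) :
    SmoothFieldAt (noetherCurrent (m := m) (n := n) δ₁ δ₂ φ X) x := by
  have hx := mem_chartDomain_self (n := m) x
  have hξ (x' : M) : SmoothAt (m := m) φ (fun x' ↦ X (φ x')) x' :=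
    SmoothFieldAt.comp (hX (φ x')) (hφ x')
  have hτ := smoothAt_tension hφ
  have hω (i : Fin m) : SmoothFunAt (m := m)
      (fun x' ↦ noetherForm (m := m) (n := n) δ₁ δ₂ φ X x' (coordVec x i x')) x := by
    have hE := smoothFieldAt_coordVec hx i
    refine SmoothFunAt.sub (SmoothFunAt.add ?_ ?_) ?_
    · exact SmoothFunAt.mul contMDiffAt_const
        ((SmoothAt.mfderiv (Eventually.of_forall fun x'' ↦ hφ x'') hE).inner (hξ x))
    · exact SmoothFunAt.mul contMDiffAt_const
        ((hτ x).inner (SmoothAt.covAlong (Eventually.of_forall hξ) hE))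
    · exact SmoothFunAt.mul contMDiffAt_const
        ((SmoothAt.covAlong (Eventually.of_forall hτ) hE).inner (hξ x))
  refine SmoothAt.congr (SmoothAt.sum (s := Finset.univ) contMDiffAt_id fun i _ ↦
    SmoothAt.sum (s := Finset.univ) contMDiffAt_id fun j _ ↦
    SmoothAt.smul (smoothFunAt_inv_metricCoeff hx i j)
      (SmoothAt.smul (hω i) (smoothFieldAt_coordVec hx j))) ?_
  filter_upwards [chartDomain_mem_nhds hx] with x' hx'
  exact noetherCurrent_eq_sum δ₁ δ₂ φ X hx'

end Traces

/-! ### Second covariant derivatives of a Killing field and curvature. -/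

section Killing

variable {n : ℕ}
  {N : Type*} [TopologicalSpace N] [ChartedSpace (EuclideanSpace ℝ (Fin n)) N]
  [IsManifold (𝓡 n) ∞ N]

/-- Extensions have constant coefficients in the coordinate frame, so bilinearity reduces this to
commuting partial derivatives. -/
lemma mvfderiv_extension_comm {f : N → ℝ} (y : N)
    (hf : ∀ᶠ y' in 𝓝 y, SmoothFunAt (m := n) f y') (u v : TangentSpace (𝓡 n) y) :
    mvfderiv (𝓡 n) (fun y' ↦ mvfderiv (𝓡 n) f y' (extension y v y')) y u =
      mvfderiv (𝓡 n) (fun y' ↦ mvfderiv (𝓡 n) f y' (extension y u y')) y v := by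
  have hy := mem_chartDomain_self (n := n) y
  have h (u v : TangentSpace (𝓡 n) y) :
      mvfderiv (𝓡 n) (fun y' ↦ mvfderiv (𝓡 n) f y' (extension y v y')) y u =
      ∑ i, ∑ j, coordForm y i y u * (coordForm y j y v *
        mvfderiv (𝓡 n) (fun y' ↦ mvfderiv (𝓡 n) f y' (coordVec y j y')) y (coordVec y i y)) := by
    have he : ∀ᶠ y' in 𝓝 y, mvfderiv (𝓡 n) f y' (extension y v y') =
        ∑ j, coordForm y j y v * mvfderiv (𝓡 n) f y' (coordVec y j y') := by
      filter_upwards [chartDomain_mem_nhds hy] with y' hy'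
      rw [extension_eq y v hy', map_sum]
      simp only [map_smul, smul_eq_mul]
    have hs (j : Fin n) : SmoothFunAt (m := n)
        (fun y' ↦ mvfderiv (𝓡 n) f y' (coordVec y j y')) y :=
      smoothFunAt_mvfderiv hf (smoothFieldAt_coordVec hy j)
    rw [mvfderiv_congr he, mvfderiv_fun_sum_apply fun j _ ↦
      SmoothFunAt.mul contMDiffAt_const (hs j), Finset.sum_comm]
    refine Finset.sum_congr rfl fun j _ ↦ ?_
    rw [mvfderiv_fun_const_mul_apply _ (hs j)]
    conv_lhs => rw [← sum_coordForm_smul_coordVec hy u, map_sum]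
    rw [Finset.mul_sum]
    refine Finset.sum_congr rfl fun i _ ↦ ?_
    rw [map_smul, smul_eq_mul]
    ring
  rw [h u v, h v u, Finset.sum_comm]
  refine Finset.sum_congr rfl fun i _ ↦ Finset.sum_congr rfl fun j _ ↦ ?_
  rw [mvfderiv_coordVec_comm hy hf]
  ring

variable [RiemannianBundle (fun y : N ↦ TangentSpace (𝓡 n) y)]

/-- The second covariant derivative `(∇²X)(a, b) = ∇_a ∇_B X - ∇_{∇_a B} X` of a vector field,
where `B` is an extension of `b`. -/
noncomputable def secondCov (X : ∀ y : N, TangentSpace (𝓡 n) y) (y : N)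
    (a b : TangentSpace (𝓡 n) y) : TangentSpace (𝓡 n) y :=
  leviCivita (fun y' ↦ leviCivita X y' (extension y b y')) y a
    - leviCivita X y (leviCivita (extension y b) y a)

lemma leviCivita_map_sub (X : ∀ y : N, TangentSpace (𝓡 n) y) (y : N)
    (a b : TangentSpace (𝓡 n) y) :
    leviCivita X y (a - b) = leviCivita X y a - leviCivita X y b := by
  have h := covAlong_map_add (fun y' : N ↦ y') X y (a - b) b
  rw [sub_add_cancel] at h
  exact eq_sub_of_add_eq h.symm

lemma leviCivita_sum_smul {ι : Type*} {s : Finset ι} {c : ι → ℝ}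
    {Y : ι → ∀ y : N, TangentSpace (𝓡 n) y} {y : N} (hY : ∀ a ∈ s, SmoothFieldAt (Y a) y)
    (v : TangentSpace (𝓡 n) y) :
    leviCivita (fun y' ↦ ∑ a ∈ s, c a • Y a y') y v = ∑ a ∈ s, c a • leviCivita (Y a) y v := by
  refine (covAlong_sum_smul (φ := fun y' : N ↦ y') (f := fun a _ ↦ c a)
    (fun a _ ↦ contMDiffAt_const) hY v).trans ?_
  refine Finset.sum_congr rfl fun a _ ↦ ?_
  rw [mvfderiv_const, zero_apply, zero_smul, zero_add]
  rfl

lemma leviCivita_extension (y : N) (u v : TangentSpace (𝓡 n) y) :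
    leviCivita (extension y v) y u = ∑ j, coordForm y j y v • leviCivita (coordVec y j) y u := by
  have hy := mem_chartDomain_self (n := n) y
  rw [← leviCivita_sum_smul fun j _ ↦ smoothFieldAt_coordVec hy j]
  exact covAlong_congr (mem_of_superset (chartDomain_mem_nhds hy) fun y' hy' ↦
    extension_eq y v hy') u

lemma leviCivita_extension_comm (y : N) (u v : TangentSpace (𝓡 n) y) :
    leviCivita (extension y v) y u = leviCivita (extension y u) y v := by
  have hy := mem_chartDomain_self (n := n) y
  have h (u v : TangentSpace (𝓡 n) y) : leviCivita (extension y v) y u =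
      ∑ i, ∑ j, (coordForm y i y u * coordForm y j y v) •
        leviCivita (coordVec y j) y (coordVec y i y) := by
    rw [leviCivita_extension, Finset.sum_comm]
    refine Finset.sum_congr rfl fun j _ ↦ ?_
    conv_lhs => rw [← sum_coordForm_smul_coordVec hy u]
    rw [leviCivita, covAlong_map_sum, Finset.smul_sum]
    exact Finset.sum_congr rfl fun i _ ↦ by rw [smul_smul, mul_comm]; rfl
  rw [h u v, h v u, Finset.sum_comm]
  refine Finset.sum_congr rfl fun i _ ↦ Finset.sum_congr rfl fun j _ ↦ ?_
  rw [leviCivita_coordVec_comm hy, mul_comm]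

lemma IsKilling.smoothFieldAt {X : ∀ y : N, TangentSpace (𝓡 n) y} (hX : IsKilling X) (y : N) :
    SmoothFieldAt X y :=
  hX.smooth y

lemma IsKilling.inner_add_inner {X : ∀ y : N, TangentSpace (𝓡 n) y} (hX : IsKilling X) (y : N)
    (u v : TangentSpace (𝓡 n) y) :
    inner ℝ (leviCivita X y u) v + inner ℝ u (leviCivita X y v) = 0 :=
  hX.lieDerivMetric_eq_zero y u v

lemma IsKilling.inner_self {X : ∀ y : N, TangentSpace (𝓡 n) y} (hX : IsKilling X) (y : N)
    (u : TangentSpace (𝓡 n) y) : inner ℝ u (leviCivita X y u) = 0 := by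
  have h := hX.inner_add_inner y u u
  rw [real_inner_comm] at h
  linarith

variable [IsContMDiffRiemannianBundle (𝓡 n) ∞ (EuclideanSpace ℝ (Fin n))
  (fun y : N ↦ TangentSpace (𝓡 n) y)]

lemma mvfderiv_inner_field {Y Z : ∀ y : N, TangentSpace (𝓡 n) y} {y : N}
    (hY : SmoothFieldAt Y y) (hZ : SmoothFieldAt Z y) (v : TangentSpace (𝓡 n) y) :
    mvfderiv (𝓡 n) (fun y' ↦ inner ℝ (Y y') (Z y')) y v =
      inner ℝ (leviCivita Y y v) (Z y) + inner ℝ (Y y) (leviCivita Z y v) :=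
  mvfderiv_inner (φ := fun y' : N ↦ y') hY hZ v

/-- For a Killing field `X`, the endomorphisms `(∇²X)(a, ·)` are skew-symmetric. -/
lemma IsKilling.inner_secondCov_add {X : ∀ y : N, TangentSpace (𝓡 n) y} (hX : IsKilling X) (y : N)
    (a b c : TangentSpace (𝓡 n) y) :
    inner ℝ (secondCov X y a b) c + inner ℝ b (secondCov X y a c) = 0 := by
  have hXs (y : N) := hX.smoothFieldAt y
  have hE (b : TangentSpace (𝓡 n) y) : SmoothFieldAt (extension y b) y :=
    smoothFieldAt_extension b (mem_chartDomain_self y)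
  have hD (b : TangentSpace (𝓡 n) y) :
      SmoothFieldAt (fun y' ↦ leviCivita X y' (extension y b y')) y :=
    SmoothFieldAt.leviCivita (Eventually.of_forall hXs) (hE b)
  -- Differentiate the Killing equation along `a`. The derivatives of the extensions of `b` and `c`
  -- that appear are absorbed by the Killing equation itself, in `h1` and `h2`.
  have h0 : mvfderiv (𝓡 n) (fun y' ↦
      inner ℝ (leviCivita X y' (extension y b y')) (extension y c y') +
      inner ℝ (extension y b y') (leviCivita X y' (extension y c y'))) y a = 0 := by
    simp only [hX.inner_add_inner, mvfderiv_const]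
    rfl
  rw [mvfderiv_fun_add_apply (SmoothAt.inner (hD b) (hE c)) (SmoothAt.inner (hE b) (hD c)),
    mvfderiv_inner_field (hD b) (hE c), mvfderiv_inner_field (hE b) (hD c)] at h0
  simp only [extension_self] at h0
  have h1 := hX.inner_add_inner y b (leviCivita (extension y c) y a)
  have h2 := hX.inner_add_inner y (leviCivita (extension y b) y a) c
  rw [secondCov, secondCov, inner_sub_left, inner_sub_right]
  linarith

/-- The curvature measures the failure of second covariant derivatives to commute. -/
lemma inner_secondCov_sub {X : ∀ y : N, TangentSpace (𝓡 n) y} (hX : ∀ y, SmoothFieldAt X y)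
    (y : N) (u v w : TangentSpace (𝓡 n) y) :
    inner ℝ (secondCov X y u v) w - inner ℝ (secondCov X y v u) w =
      - inner ℝ (X y) (curvature y u v w) := by
  have hX' : ∀ᶠ y' in 𝓝 y, SmoothFieldAt X y' := Eventually.of_forall hX
  have hE (b : TangentSpace (𝓡 n) y) := eventually_smoothFieldAt_extension y b
  have hf : ∀ᶠ y' in 𝓝 y, SmoothFunAt (m := n) (fun y' ↦ inner ℝ (X y') (extension y w y')) y' :=
    (hE w).mono fun y' h ↦ SmoothAt.inner (hX y') h
  have hD (b : TangentSpace (𝓡 n) y) :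
      SmoothFieldAt (fun y' ↦ leviCivita X y' (extension y b y')) y :=
    SmoothFieldAt.leviCivita hX' (hE b).self_of_nhds
  have hW (b : TangentSpace (𝓡 n) y) :
      SmoothFieldAt (fun y' ↦ leviCivita (extension y w) y' (extension y b y')) y :=
    SmoothFieldAt.leviCivita (hE w) (hE b).self_of_nhds
  -- Commute two derivatives of the function ⟨X, W⟩. The mixed first-order terms are symmetric in
  -- `u` and `v` and cancel, leaving ∇²X on one side and the curvature acting on W on the other. As
  -- R acts on the extension of `w` rather than on `X`, neither tensoriality nor skewness of R is
  -- needed.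
  have key (u v : TangentSpace (𝓡 n) y) : mvfderiv (𝓡 n) (fun y' ↦
      mvfderiv (𝓡 n) (fun y' ↦ inner ℝ (X y') (extension y w y')) y' (extension y v y')) y u =
      (inner ℝ (leviCivita (fun y' ↦ leviCivita X y' (extension y v y')) y u) w +
        inner ℝ (leviCivita X y v) (leviCivita (extension y w) y u)) +
      (inner ℝ (leviCivita X y u) (leviCivita (extension y w) y v) +
        inner ℝ (X y)
          (leviCivita (fun y' ↦ leviCivita (extension y w) y' (extension y v y')) y u)) := by
    rw [mvfderiv_congr ((hE w).mono fun y' h ↦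
        mvfderiv_inner_field (hX y') h (extension y v y')),
      mvfderiv_fun_add_apply (SmoothAt.inner (hD v) (hE w).self_of_nhds)
        (SmoothAt.inner (hX y) (hW v)),
      mvfderiv_inner_field (hD v) (hE w).self_of_nhds, mvfderiv_inner_field (hX y) (hW v)]
    simp only [extension_self]
  have h := mvfderiv_extension_comm y hf u v
  rw [key, key] at h
  have h0 : leviCivita (extension y w) y (0 : TangentSpace (𝓡 n) y) = 0 := by
    have := leviCivita_map_sub (extension y w) y 0 0
    simpa using this
  rw [curvature, mlieBracket_extension, h0, sub_zero, inner_sub_right, secondCov, secondCov,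
    leviCivita_extension_comm y u v, inner_sub_left, inner_sub_left]
  linarith

/-- The consequence `⟨t, (∇²X)(u, u)⟩ = ⟨X, R(u, t) u⟩` of the Killing equation. -/
lemma IsKilling.inner_secondCov_self {X : ∀ y : N, TangentSpace (𝓡 n) y} (hX : IsKilling X)
    (y : N) (t u : TangentSpace (𝓡 n) y) :
    inner ℝ t (secondCov X y u u) = inner ℝ (X y) (curvature y u t u) := by
  have h1 := hX.inner_secondCov_add y u t u
  have h2 := inner_secondCov_sub hX.smoothFieldAt y u t u
  -- Skewness of (∇²X)(t, ·) kills ⟨(∇²X)(t, u), u⟩, so exchanging `u` and `t` costs just the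
  -- curvature term and no Bianchi identity enters.
  have h3 := hX.inner_secondCov_add y t u u
  rw [real_inner_comm _ u] at h3
  linarith

end Killing

/-! ### The chain rule for second derivatives and the divergence of the current. -/

section Divergence

variable {m n : ℕ}
  {M : Type*} [TopologicalSpace M] [ChartedSpace (EuclideanSpace ℝ (Fin m)) M]
  [IsManifold (𝓡 m) ∞ M] [RiemannianBundle (fun x : M ↦ TangentSpace (𝓡 m) x)]
  {N : Type*} [TopologicalSpace N] [ChartedSpace (EuclideanSpace ℝ (Fin n)) N]
  [IsManifold (𝓡 n) ∞ N] [RiemannianBundle (fun y : N ↦ TangentSpace (𝓡 n) y)]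

/-- The summand `∇_v ∇_W σ - ∇_{∇_v W} σ` of the connection Laplacian. -/
noncomputable def secondCovAlong (φ : M → N) (σ : ∀ x : M, TangentSpace (𝓡 n) (φ x)) (x : M)
    (v w : TangentSpace (𝓡 m) x) : TangentSpace (𝓡 n) (φ x) :=
  covAlong φ (fun x' ↦ covAlong φ σ x' (extension x w x')) x v
    - covAlong φ σ x (leviCivita (extension x w) x v)

variable [IsContMDiffRiemannianBundle (𝓡 n) ∞ (EuclideanSpace ℝ (Fin n))
  (fun y : N ↦ TangentSpace (𝓡 n) y)]

/-- The chain rule for second covariant derivatives. -/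
lemma secondCovAlong_comp {φ : M → N} (hφ : ContMDiff (𝓡 m) (𝓡 n) ∞ φ)
    {X : ∀ y : N, TangentSpace (𝓡 n) y} (hX : ∀ y, SmoothFieldAt X y) (x : M)
    (v w : TangentSpace (𝓡 m) x) :
    secondCovAlong φ (fun x' ↦ X (φ x')) x v w =
      secondCov X (φ x) (mfderiv (𝓡 m) (𝓡 n) φ x v) (mfderiv (𝓡 m) (𝓡 n) φ x w) +
        leviCivita X (φ x) (hessian φ x v w) := by
  have hy := mem_chartDomain_self (n := n) (φ x)
  have hE := smoothFieldAt_extension w (mem_chartDomain_self (n := m) x)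
  have hdE : SmoothAt (m := m) φ (fun x' ↦ mfderiv (𝓡 m) (𝓡 n) φ x' (extension x w x')) x :=
    SmoothAt.mfderiv (Eventually.of_forall fun x' ↦ hφ x') hE
  have hs (k : Fin n) := hdE.coord hy k
  have hF (k : Fin n) := smoothFieldAt_coordVec hy k
  have hG (k : Fin n) :
      SmoothFieldAt (fun y' ↦ leviCivita X y' (coordVec (φ x) k y')) (φ x) :=
    SmoothFieldAt.leviCivita (Eventually.of_forall hX) (hF k)
  have hmem := (hφ x).continuousAt.eventually (chartDomain_mem_nhds hy)
  set b := mfderiv (𝓡 m) (𝓡 n) φ x w with hb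
  set a := mfderiv (𝓡 m) (𝓡 n) φ x v with ha
  -- The functions `s k` are the components of dφ(W) in the frame at `φ x`, W extending w. In `h1`
  -- and `h2` their derivatives multiply ∇_{∂_k} X and ∂_k, so these terms match after applying ∇X
  -- to the Hessian; their values at `x` account for the ∇²X term.
  set s : Fin n → M → ℝ := fun k x' ↦
    coordForm (φ x) k (φ x') (mfderiv (𝓡 m) (𝓡 n) φ x' (extension x w x')) with hsdef
  have hsx (k : Fin n) : s k x = coordForm (φ x) k (φ x) b := by
    simp only [hsdef, extension_self, hb]
  have h1 : covAlong φ (fun x' ↦ covAlong φ (fun x' ↦ X (φ x')) x' (extension x w x')) x v =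
      ∑ k, (mvfderiv (𝓡 m) (s k) x v • leviCivita X (φ x) (coordVec (φ x) k (φ x)) +
        s k x • leviCivita (fun y' ↦ leviCivita X y' (coordVec (φ x) k y')) (φ x) a) := by
    rw [← covAlong_sum_smul_comp (hφ x) (fun k _ ↦ hs k) (fun k _ ↦ hG k)]
    refine covAlong_congr (hmem.mono fun x' hx' ↦ ?_) v
    rw [covAlong_comp (hφ x') (hX _)]
    conv_lhs => rw [← sum_coordForm_smul_coordVec hx'
      (mfderiv (𝓡 m) (𝓡 n) φ x' (extension x w x'))]
    rw [leviCivita, covAlong_map_sum]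
    rfl
  have h2 : covAlong φ (fun x' ↦ mfderiv (𝓡 m) (𝓡 n) φ x' (extension x w x')) x v =
      ∑ k, (mvfderiv (𝓡 m) (s k) x v • coordVec (φ x) k (φ x) +
        s k x • leviCivita (coordVec (φ x) k) (φ x) a) := by
    rw [← covAlong_sum_smul_comp (hφ x) (fun k _ ↦ hs k) (fun k _ ↦ hF k)]
    exact covAlong_congr (hmem.mono fun x' hx' ↦ (sum_coordForm_smul_coordVec hx' _).symm) v
  have h3 : leviCivita (fun y' ↦ leviCivita X y' (extension (φ x) b y')) (φ x) a =
      ∑ k, s k x • leviCivita (fun y' ↦ leviCivita X y' (coordVec (φ x) k y')) (φ x) a := by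
    simp only [hsx]
    rw [← leviCivita_sum_smul fun k _ ↦ hG k]
    refine covAlong_congr (mem_of_superset (chartDomain_mem_nhds hy) fun y' hy' ↦ ?_) a
    change leviCivita X y' (extension (φ x) b y') = _
    rw [extension_eq _ b hy', leviCivita, covAlong_map_sum]
    rfl
  let D : TangentSpace (𝓡 n) (φ x) →ₗ[ℝ] TangentSpace (𝓡 n) (φ x) :=
    { toFun := leviCivita X (φ x)
      map_add' := covAlong_map_add (fun y' : N ↦ y') X (φ x)
      map_smul' := covAlong_map_smul (fun y' : N ↦ y') X (φ x) }
  have hD (z : TangentSpace (𝓡 n) (φ x)) : leviCivita X (φ x) z = D z := rfl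
  rw [secondCovAlong, secondCov, hessian, covAlong_comp (hφ x) (hX _), h1, h2, h3,
    leviCivita_extension (φ x) a b]
  simp only [hD, map_sub, map_sum, map_add, map_smul, Finset.sum_add_distrib, hsx]
  abel

variable [IsContMDiffRiemannianBundle (𝓡 m) ∞ (EuclideanSpace ℝ (Fin m))
  (fun x : M ↦ TangentSpace (𝓡 m) x)]

/-- The contribution of a single vector to the divergence, for an arbitrary extension field E of e
instead of a normal frame. The term ⟨J, ∇_e E⟩ is the Noether form evaluated at ∇_e E, and supplies
exactly the corrections occurring in `hessian` and `secondCovAlong`. -/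
lemma inner_leviCivita_noetherCurrent (δ₁ δ₂ : ℝ) {φ : M → N} (hφ : ContMDiff (𝓡 m) (𝓡 n) ∞ φ)
    {X : ∀ y : N, TangentSpace (𝓡 n) y} (hX : ∀ y, SmoothFieldAt X y) (x : M)
    (e : TangentSpace (𝓡 m) x) :
    inner ℝ (leviCivita (noetherCurrent (m := m) (n := n) δ₁ δ₂ φ X) x e) e =
      δ₁ * (inner ℝ (hessian (m := m) (n := n) φ x e e) (X (φ x)) +
        inner ℝ (mfderiv (𝓡 m) (𝓡 n) φ x e)
          (leviCivita X (φ x) (mfderiv (𝓡 m) (𝓡 n) φ x e))) +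
      δ₂ * inner ℝ (tension (m := m) (n := n) φ x)
        (secondCovAlong φ (fun x' ↦ X (φ x')) x e e) -
      δ₂ * inner ℝ (secondCovAlong φ (tension (m := m) (n := n) φ) x e e) (X (φ x)) := by
  have hE := smoothFieldAt_extension e (mem_chartDomain_self (n := m) x)
  have hξ (x' : M) : SmoothAt (m := m) φ (fun x' ↦ X (φ x')) x' :=
    SmoothFieldAt.comp (hX (φ x')) (hφ x')
  have hτ := smoothAt_tension (m := m) (n := n) hφ
  have hJ := smoothFieldAt_noetherCurrent (m := m) (n := n) δ₁ δ₂ hφ hX x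
  have hdE := SmoothAt.mfderiv (Eventually.of_forall fun x' ↦ hφ x') hE
  have hDξ := SmoothAt.covAlong (Eventually.of_forall hξ) hE
  have hDτ := SmoothAt.covAlong (Eventually.of_forall hτ) hE
  have h1 := mvfderiv_inner_field hJ hE e
  simp only [inner_noetherCurrent, extension_self] at h1
  have hc (δ : ℝ) : SmoothFunAt (m := m) (fun _ : M ↦ δ) x := contMDiffAt_const
  have h2 : mvfderiv (𝓡 m) (fun x' ↦ noetherForm (m := m) (n := n) δ₁ δ₂ φ X x'
      (extension x e x')) x e =
      δ₁ * mvfderiv (𝓡 m) (fun x' ↦ inner ℝ (mfderiv (𝓡 m) (𝓡 n) φ x' (extension x e x'))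
        (X (φ x'))) x e +
      δ₂ * mvfderiv (𝓡 m) (fun x' ↦ inner ℝ (tension (m := m) (n := n) φ x')
        (covAlong φ (fun x' ↦ X (φ x')) x' (extension x e x'))) x e +
      (-δ₂) * mvfderiv (𝓡 m) (fun x' ↦ inner ℝ
        (covAlong φ (tension (m := m) (n := n) φ) x' (extension x e x')) (X (φ x'))) x e := by
    rw [← mvfderiv_fun_const_mul_apply δ₁ (hdE.inner (hξ x)),
      ← mvfderiv_fun_const_mul_apply δ₂ ((hτ x).inner hDξ),
      ← mvfderiv_fun_const_mul_apply (-δ₂) (hDτ.inner (hξ x)),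
      ← mvfderiv_fun_add_apply ((hc δ₁).mul (hdE.inner (hξ x)))
        ((hc δ₂).mul ((hτ x).inner hDξ)),
      ← mvfderiv_fun_add_apply (((hc δ₁).mul (hdE.inner (hξ x))).add
        ((hc δ₂).mul ((hτ x).inner hDξ))) ((hc (-δ₂)).mul (hDτ.inner (hξ x)))]
    simp only [noetherForm, neg_mul, sub_eq_add_neg]
  rw [mvfderiv_inner hdE (hξ x), mvfderiv_inner (hτ x) hDξ, mvfderiv_inner hDτ (hξ x)] at h2
  simp only [extension_self] at h2
  rw [h2, noetherForm] at h1
  rw [hessian, secondCovAlong, secondCovAlong, inner_sub_left, inner_sub_left, inner_sub_right,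
    ← covAlong_comp (hφ x) (hX _)]
  -- The two copies of δ₂⟨∇_e τ, ∇_e X(φ)⟩ have opposite signs and cancel here.
  linarith

/-- The Noether current of a semi-biharmonic map and a Killing field is divergence free. -/
theorem divergence_noetherCurrent (δ₁ δ₂ : ℝ) {φ : M → N} (hφ : ContMDiff (𝓡 m) (𝓡 n) ∞ φ)
    (hsemi : IsSemiBiharmonic (m := m) (n := n) δ₁ δ₂ φ)
    {X : ∀ y : N, TangentSpace (𝓡 n) y} (hX : IsKilling X) (x : M) :
    divergence (noetherCurrent (m := m) (n := n) δ₁ δ₂ φ X) x = 0 := by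
  set τ := tension (m := m) (n := n) φ x with hτ
  set de : Fin (Module.finrank ℝ (TangentSpace (𝓡 m) x)) → TangentSpace (𝓡 n) (φ x) :=
    fun α ↦ mfderiv (𝓡 m) (𝓡 n) φ x (onb x α) with hde
  -- Only the Killing property enters here; the equation for φ is used afterwards, paired with X(φ).
  have hsum : divergence (noetherCurrent (m := m) (n := n) δ₁ δ₂ φ X) x =
      δ₁ * inner ℝ τ (X (φ x)) +
      δ₂ * inner ℝ (X (φ x)) (∑ α, curvature (φ x) (de α) τ (de α)) +
      δ₂ * inner ℝ τ (leviCivita X (φ x) τ) -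
      δ₂ * inner ℝ (connLaplacian (m := m) (n := n) φ (tension (m := m) (n := n) φ) x)
        (X (φ x)) := by
    have hL : connLaplacian (m := m) (n := n) φ (tension (m := m) (n := n) φ) x =
        ∑ α, secondCovAlong φ (tension (m := m) (n := n) φ) x (onb x α) (onb x α) := rfl
    have hH : τ = ∑ α, hessian (m := m) (n := n) φ x (onb x α) (onb x α) := rfl
    have hDτ : leviCivita X (φ x) τ =
        ∑ α, leviCivita X (φ x) (hessian (m := m) (n := n) φ x (onb x α) (onb x α)) := by
      have := covAlong_map_sum Finset.univ (fun y' : N ↦ y') X (φ x) (fun _ ↦ 1)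
        (fun α ↦ hessian (m := m) (n := n) φ x (onb x α) (onb x α))
      simp only [one_smul, ← hH] at this
      exact this
    have hτX : inner ℝ τ (X (φ x)) =
        ∑ α, inner ℝ (hessian (m := m) (n := n) φ x (onb x α) (onb x α)) (X (φ x)) := by
      rw [hH, sum_inner]
    have hdiv : divergence (noetherCurrent (m := m) (n := n) δ₁ δ₂ φ X) x =
        ∑ α, inner ℝ (leviCivita (noetherCurrent (m := m) (n := n) δ₁ δ₂ φ X) x (onb x α))
          (onb x α) := rfl
    rw [hdiv, hτX, hDτ, hL, inner_sum, inner_sum, sum_inner, Finset.mul_sum, Finset.mul_sum,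
      Finset.mul_sum, Finset.mul_sum, ← Finset.sum_add_distrib, ← Finset.sum_add_distrib,
      ← Finset.sum_sub_distrib]
    refine Finset.sum_congr rfl fun α _ ↦ ?_
    rw [inner_leviCivita_noetherCurrent δ₁ δ₂ hφ hX.smoothFieldAt,
      secondCovAlong_comp hφ hX.smoothFieldAt, inner_add_right, hX.inner_self,
      hX.inner_secondCov_self]
    ring
  have h := congrArg (fun z ↦ inner ℝ z (X (φ x))) (hsemi x)
  simp only [inner_add_left, real_inner_smul_left] at h
  have hR : metricTrace x (fun v w ↦ curvature (φ x) (mfderiv (𝓡 m) (𝓡 n) φ x v)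
      (tension (m := m) (n := n) φ x) (mfderiv (𝓡 m) (𝓡 n) φ x w)) =
      ∑ α, curvature (φ x) (de α) τ (de α) := rfl
  rw [hsum, hX.inner_self, h, hR, ← hτ, real_inner_comm (X (φ x)) (∑ α, _)]
  ring

end Divergence

end SemiBiharmonic

theorem mainTheorem10 {m n : ℕ}
    {M : Type*} [TopologicalSpace M] [ChartedSpace (EuclideanSpace ℝ (Fin m)) M]
    [IsManifold (𝓡 m) ∞ M] [RiemannianBundle (fun x : M ↦ TangentSpace (𝓡 m) x)]
    [IsContMDiffRiemannianBundle (𝓡 m) ∞ (EuclideanSpace ℝ (Fin m))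
      (fun x : M ↦ TangentSpace (𝓡 m) x)]
    {N : Type*} [TopologicalSpace N] [ChartedSpace (EuclideanSpace ℝ (Fin n)) N]
    [IsManifold (𝓡 n) ∞ N] [RiemannianBundle (fun y : N ↦ TangentSpace (𝓡 n) y)]
    [IsContMDiffRiemannianBundle (𝓡 n) ∞ (EuclideanSpace ℝ (Fin n))
      (fun y : N ↦ TangentSpace (𝓡 n) y)]
    (δ₁ δ₂ : ℝ) (φ : M → N) (hφ : ContMDiff (𝓡 m) (𝓡 n) ∞ φ)
    (hsemi : SemiBiharmonic.IsSemiBiharmonic (m := m) (n := n) δ₁ δ₂ φ)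
    (X : ∀ y : N, TangentSpace (𝓡 n) y) (hX : SemiBiharmonic.IsKilling (n := n) X) :
    ContMDiff (𝓡 m) (𝓡 m).tangent ∞
        (fun x ↦ (⟨x, SemiBiharmonic.noetherCurrent (m := m) (n := n) δ₁ δ₂ φ X x⟩ : TangentBundle (𝓡 m) M)) ∧
      ∀ x : M, SemiBiharmonic.divergence (n := m)
        (SemiBiharmonic.noetherCurrent (m := m) (n := n) δ₁ δ₂ φ X) x = 0 := by
  exact ⟨fun x ↦ SemiBiharmonic.smoothFieldAt_noetherCurrent δ₁ δ₂ hφ hX.smoothFieldAt x,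
    fun x ↦ SemiBiharmonic.divergence_noetherCurrent δ₁ δ₂ hφ hsemi hX x⟩
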